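/- **Setting.** Let $\mathcal V$ be a uniformly discrete subset of the $xy$-plane in $\mathbb R^3$ and $\mathcal E\subset\mathcal V\times\mathcal V$ a set of directed edges $\alpha\beta$ (from $\alpha$ to $\beta$), of length $l_{\alpha\beta}=|\beta-\alpha|$ and direction $e_{\alpha\beta}=(\beta-\alpha)/l_{\alpha\beta}$, such that $0<\inf l_{\alpha\beta}\le\sup l_{\alpha\beta}<\infty$ and, for some $N$, every vertex has total degree (in plus out) between $1$ and $N$. Identify $\alpha\beta$ with $[0,l_{\alpha\beta}]$. Let $U_{\alpha\beta}\in L^2[0,l_{\alpha\beta}]$ be real with $\sup\|U_{\alpha\beta}\|_{L^2}<\infty$, let $A\in C^1(\mathbb R^3,\mathbb R^3)$, $k_R\in\mathbb R$ and $\epsilon:\mathcal V\to\mathbb R$. Put $$a_{\alpha\beta}(t)=\langle A(\alpha+te_{\alpha\beta}),e_{\alpha\beta}\rangle,\quad \sigma_{\alpha\beta}=\begin{pmatrix}0&e_{\alpha\beta,2}+\mathrm i e_{\alpha\beta,1}\\ e_{\alpha\beta,2}-\mathrm i e_{\alpha\beta,1}&0\end{pmatrix},$$ $$L_{\alpha\beta}=\Big(\mathrm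 i\frac{d}{dt}+a_{\alpha\beta}+k_R\sigma_{\alpha\beta}\Big)^2+U_{\alpha\beta}-k_R^2,$$ $$\Theta_{\alpha\beta}(t)=\exp\Big(\mathrm i\int_0^t(a_{\alpha\beta}(r)+k_R\sigma_{\alpha\beta})\,dr\Big),\qquad \tau_{\alpha\beta}=\Theta_{\alpha\beta}(l_{\alpha\beta}).$$ Let $\mathcal H=\bigoplus_{\alpha\beta\in\mathcal E}L^2([0,l_{\alpha\beta}],\mathbb C^2)$. Let $D$ be the operator $(f_{\alpha\beta})\mapsto(L_{\alpha\beta}f_{\alpha\beta})$ in $\mathcal H$ whose domain consists of the $f\in\mathcal H$ with $f_{\alpha\beta}\in H^2$, $f_{\alpha\beta}(0)=f_{\alpha\beta}(l_{\alpha\beta})=0$ for every edge and $(L_{\alpha\beta}f_{\alpha\beta})\in\mathcal H$. Let $L$ be the operator acting by the same rule on the $f\in\mathcal H$ with $f_{\alpha\beta}\in H^2$, $(L_{\alpha\beta}f_{\alpha\beta})\in\mathcal H$, that are continuous at all vertices, i.e. there are values $f(\alpha)$ with $f_{\alpha\beta}(0)=f(\alpha)$ and $f_{\alpha\beta}(l_{\alpha\beta})=f(\beta)$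 for all edges $\alpha\beta$, and satisfy at every vertex $\alpha$ the condition $$\sum_{\alpha\beta\in\mathcal E}\Big[\frac{d}{dt}-\mathrm i(a_{\alpha\beta}+k_R\sigma_{\alpha\beta})\Big]f_{\alpha\beta}(0)-\sum_{\beta\alpha\in\mathcal E}\Big[\frac{d}{dt}-\mathrm i(a_{\beta\alpha}+k_R\sigma_{\beta\alpha})\Big]f_{\beta\alpha}(l_{\beta\alpha})=\epsilon(\alpha)f(\alpha).\tag{1}$$ For $z\in\mathbb C$ let $s_{\alpha\beta}(\cdot;z)$ and $c_{\alpha\beta}(\cdot;z)$ be the solutions of $-y''+U_{\alpha\beta}y=zy$ on $[0,l_{\alpha\beta}]$ with $s(0)=c'(0)=0$, $s'(0)=c(0)=1$. A *continuous solution of $(L-E)f=0$* is a family $f=(f_{\alpha\beta})$ with $f_{\alpha\beta}\in H^2([0,l_{\alpha\beta}],\mathbb C^2)$ and $L_{\alpha\beta}f_{\alpha\beta}=Ef_{\alpha\beta}$ a.e. on each edge which is continuous at all vertices; neither $f\in\mathcal H$ nor (1) is required. **Theorem.** Let $E\in\mathbb C\setminus\operatorname{spec}D$ and $z=E+k_R^2$.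 Then $s_{\alpha\beta}(l_{\alpha\beta};z)\ne0$ for every edge, and every continuous solution $f$ of $(L-E)f=0$ has the following properties. 1. For every edge $\alpha\beta$ and $t\in[0,l_{\alpha\beta}]$, $$f_{\alpha\beta}(t)=\frac{s_{\alpha\beta}(t;z)}{s_{\alpha\beta}(l_{\alpha\beta};z)}\,\Theta_{\alpha\beta}(t)\big[\tau_{\alpha\beta}^*f(\beta)-c_{\alpha\beta}(l_{\alpha\beta};z)f(\alpha)\big]+\Theta_{\alpha\beta}(t)\,c_{\alpha\beta}(t;z)\,f(\alpha).$$ 2. For every vertex $\alpha$, condition (1) holds at $\alpha$ if and only if $$\sum_{\alpha\beta\in\mathcal E}\frac{\tau_{\alpha\beta}^*f(\beta)}{s_{\alpha\beta}(l_{\alpha\beta};z)}+\sum_{\beta\alpha\in\mathcal E}\frac{\tau_{\beta\alpha}f(\beta)}{s_{\beta\alpha}(l_{\beta\alpha};z)}=\Big[\sum_{\alpha\beta\in\mathcal E}\frac{c_{\alpha\beta}(l_{\alpha\beta};z)}{s_{\alpha\beta}(l_{\alpha\beta};z)}+\sum_{\beta\alpha\in\mathcal E}\frac{s_{\beta\alpha}'(l_{\beta\alpha};z)}{s_{\beta\alpha}(l_{\beta\alpha};z)}+\epsilon(\alpha)\Big]f(\alpha).$$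 3. $f\in\mathcal H$ if and only if $(f(\alpha))_{\alpha\in\mathcal V}\in\ell^2(\mathcal V,\mathbb C^2)$. In particular, if $f$ is not identically zero and satisfies (1) at every vertex, then $f$ is an eigenfunction of $L$ with eigenvalue $E$ if and only if $(f(\alpha))_{\alpha\in\mathcal V}\in\ell^2(\mathcal V,\mathbb C^2)$. -/

import Mathlib

open MeasureTheory Set
open scoped ENNReal

noncomputable section

/-- The ambient space `ℝ³`. -/
abbrev Space3 : Type := EuclideanSpace ℝ (Fin 3)

/-- The spinor space `ℂ²`. -/
abbrev Spinor : Type := EuclideanSpace ℂ (Fin 2)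

/-- The derivative of a function on the segment `[0, l]` (one-sided at the ends). -/
def segDeriv {F : Type*} [NormedAddCommGroup F] [NormedSpace ℝ F] (l : ℝ) (f : ℝ → F) : ℝ → F :=
  fun t => derivWithin f (Icc 0 l) t

/-- `f` (restricted to `[0, l]`) is an element of the Sobolev space `H²([0, l], F)`, given by its
continuously differentiable representative: `f` is differentiable on `[0, l]`, and its derivative is
absolutely continuous with (a.e.) derivative `g ∈ L²`. -/
structure MemH2 {F : Type*} [NormedAddCommGroup F] [NormedSpace ℝ F] (l : ℝ) (f : ℝ → F) :
    Prop where
  differentiableOn : DifferentiableOn ℝ f (Icc 0 l)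
  exists_second : ∃ g : ℝ → F, MemLp g 2 (volume.restrict (Icc 0 l)) ∧
    ∀ t ∈ Icc 0 l, segDeriv l f t = segDeriv l f 0 + ∫ s in (0 : ℝ)..t, g s

/-- The data and the standing assumptions: a metric graph with straight edges in the `xy`-plane of
`ℝ³`, scalar potentials on the edges, a magnetic vector potential, a Rashba constant and coupling
constants at the vertices. A pair `(α, β) ∈ edges` is the directed edge from `α` to `β`. -/
structure RashbaNetwork where
  vertices : Set Space3
  planar : ∀ α ∈ vertices, α 2 = 0
  uniformly_discrete : ∃ d : ℝ, 0 < d ∧ ∀ α ∈ vertices, ∀ β ∈ vertices, α ≠ β → d ≤ dist α β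
  edges : Set (Space3 × Space3)
  edges_subset : edges ⊆ vertices ×ˢ vertices
  degree_bounds : ∃ N : ℕ, ∀ α ∈ vertices,
    1 ≤ {e ∈ edges | e.1 = α}.encard + {e ∈ edges | e.2 = α}.encard ∧
    {e ∈ edges | e.1 = α}.encard + {e ∈ edges | e.2 = α}.encard ≤ N
  length_bounds : ∃ a b : ℝ, 0 < a ∧ ∀ e ∈ edges, a ≤ dist e.1 e.2 ∧ dist e.1 e.2 ≤ b
  /-- scalar potentials on the edges -/
  U : edges → ℝ → ℝ
  memLp_U : ∀ e : edges, MemLp (U e) 2 (volume.restrict (Icc 0 (dist e.1.1 e.1.2)))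
  bounded_U : ∃ C : ℝ, ∀ e : edges,
    eLpNorm (U e) 2 (volume.restrict (Icc 0 (dist e.1.1 e.1.2))) ≤ ENNReal.ofReal C
  /-- magnetic vector potential -/
  A : Space3 → Space3
  contDiff_A : ContDiff ℝ 1 A
  /-- Rashba constant -/
  kR : ℝ
  /-- coupling constants -/
  ε : vertices → ℝ

namespace RashbaNetwork

abbrev Vertex (Q : RashbaNetwork) : Type := Q.vertices

abbrev Edge (Q : RashbaNetwork) : Type := Q.edges

/-- initial vertex -/
def src (Q : RashbaNetwork) (e : Q.Edge) : Q.Vertex := ⟨e.1.1, (Q.edges_subset e.2).1⟩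

/-- terminal vertex -/
def tgt (Q : RashbaNetwork) (e : Q.Edge) : Q.Vertex := ⟨e.1.2, (Q.edges_subset e.2).2⟩

/-- the set of edges starting at `α` -/
def outEdges (Q : RashbaNetwork) (α : Q.Vertex) : Set Q.Edge := {e | Q.src e = α}

/-- the set of edges ending at `α` -/
def inEdges (Q : RashbaNetwork) (α : Q.Vertex) : Set Q.Edge := {e | Q.tgt e = α}

/-- length of an edge -/
def len (Q : RashbaNetwork) (e : Q.Edge) : ℝ := dist e.1.1 e.1.2

/-- unit direction vector of an edge -/
def dir (Q : RashbaNetwork) (e : Q.Edge) : Space3 := (Q.len e)⁻¹ • (e.1.2 - e.1.1)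

/-- Lebesgue measure on the segment `[0, l]` of an edge of length `l` -/
def edgeMeasure (Q : RashbaNetwork) (e : Q.Edge) : Measure ℝ := volume.restrict (Icc 0 (Q.len e))

/-- magnetic potential along an edge -/
def a (Q : RashbaNetwork) (e : Q.Edge) (t : ℝ) : ℝ := inner ℝ (Q.A (e.1.1 + t • Q.dir e)) (Q.dir e)

/-- the spin matrix `σ` of an edge, as an operator in `ℂ²` -/
def σ (Q : RashbaNetwork) (e : Q.Edge) : Spinor →L[ℂ] Spinor :=
  Matrix.toEuclideanCLM (𝕜 := ℂ) (n := Fin 2)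
    !![0, (Q.dir e 1 : ℂ) + Complex.I * (Q.dir e 0 : ℂ);
       (Q.dir e 1 : ℂ) - Complex.I * (Q.dir e 0 : ℂ), 0]

/-- the total gauge potential `a(t) + k_R σ` of an edge -/
def gauge (Q : RashbaNetwork) (e : Q.Edge) (t : ℝ) : Spinor →L[ℂ] Spinor :=
  (Q.a e t : ℂ) • (1 : Spinor →L[ℂ] Spinor) + (Q.kR : ℂ) • Q.σ e

/-- `Θ(t) = exp (i ∫₀ᵗ (a(s) + k_R σ) ds)` -/
def Θ (Q : RashbaNetwork) (e : Q.Edge) (t : ℝ) : Spinor →L[ℂ] Spinor :=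
  NormedSpace.exp (Complex.I • ∫ s in (0 : ℝ)..t, Q.gauge e s)

/-- `τ = Θ(l)`, where `l` is the length of the edge -/
def τ (Q : RashbaNetwork) (e : Q.Edge) : Spinor →L[ℂ] Spinor := Q.Θ e (Q.len e)

/-- the operation `(i d/dt + a + k_R σ) f` on an edge -/
def momentum (Q : RashbaNetwork) (e : Q.Edge) (f : ℝ → Spinor) : ℝ → Spinor :=
  fun t => Complex.I • segDeriv (Q.len e) f t + Q.gauge e t (f t)

/-- the differential expression `((i d/dt + a + k_R σ)² + U - k_R²) f` on an edge -/
def edgeOp (Q : RashbaNetwork) (e : Q.Edge) (f : ℝ → Spinor) : ℝ → Spinor :=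
  fun t => Q.momentum e (Q.momentum e f) t + ((Q.U e t - Q.kR ^ 2 : ℝ) : ℂ) • f t

/-- the covariant derivative `(d/dt - i (a + k_R σ)) f` on an edge -/
def covDeriv (Q : RashbaNetwork) (e : Q.Edge) (f : ℝ → Spinor) : ℝ → Spinor :=
  fun t => segDeriv (Q.len e) f t - Complex.I • Q.gauge e t (f t)

/-- The family `f` is continuous at all vertices, with value `ξ α` at the vertex `α`. -/
def HasVertexValues (Q : RashbaNetwork) (f : Q.Edge → ℝ → Spinor) (ξ : Q.Vertex → Spinor) : Prop :=
  ∀ e, f e 0 = ξ (Q.src e) ∧ f e (Q.len e) = ξ (Q.tgt e)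

/-- the sum of the outgoing covariant derivatives at a vertex -/
def flux (Q : RashbaNetwork) (f : Q.Edge → ℝ → Spinor) (α : Q.Vertex) : Spinor :=
  (∑ᶠ e ∈ Q.outEdges α, Q.covDeriv e (f e) 0) -
    ∑ᶠ e ∈ Q.inEdges α, Q.covDeriv e (f e) (Q.len e)

/-- A continuous solution of `(L - E) f = 0` with vertex values `ξ`: each component is in `H²` of its
edge and satisfies the differential equation there (almost everywhere), and `f` is continuous at all
vertices. No integrability over the whole graph is required. -/
structure IsContinuousSolution (Q : RashbaNetwork) (E : ℂ) (f : Q.Edge → ℝ → Spinor)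
    (ξ : Q.Vertex → Spinor) : Prop where
  memH2 : ∀ e, MemH2 (Q.len e) (f e)
  vertexValues : Q.HasVertexValues f ξ
  equation : ∀ e, ∀ᵐ t ∂(Q.edgeMeasure e), Q.edgeOp e (f e) t = E • f e t

/-- `y ∈ H²[0, l]` solves `-y'' + U y = z y` on the edge (almost everywhere). -/
def IsScalarSolution (Q : RashbaNetwork) (e : Q.Edge) (z : ℂ) (y : ℝ → ℂ) : Prop :=
  MemH2 (Q.len e) y ∧ ∀ᵐ t ∂(Q.edgeMeasure e),
    -segDeriv (Q.len e) (segDeriv (Q.len e) y) t + (Q.U e t : ℂ) * y t = z * y t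

/-- `y` is the solution of `-y'' + U y = z y` with `y(0) = 0`, `y'(0) = 1`. -/
def IsSineSolution (Q : RashbaNetwork) (e : Q.Edge) (z : ℂ) (y : ℝ → ℂ) : Prop :=
  Q.IsScalarSolution e z y ∧ y 0 = 0 ∧ segDeriv (Q.len e) y 0 = 1

/-- `y` is the solution of `-y'' + U y = z y` with `y(0) = 1`, `y'(0) = 0`. -/
def IsCosineSolution (Q : RashbaNetwork) (e : Q.Edge) (z : ℂ) (y : ℝ → ℂ) : Prop :=
  Q.IsScalarSolution e z y ∧ y 0 = 1 ∧ segDeriv (Q.len e) y 0 = 0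

/-- the solution `s(·; z)` on an edge -/
def s (Q : RashbaNetwork) (e : Q.Edge) (z : ℂ) : ℝ → ℂ := Classical.epsilon (Q.IsSineSolution e z)

/-- the solution `c(·; z)` on an edge -/
def c (Q : RashbaNetwork) (e : Q.Edge) (z : ℂ) : ℝ → ℂ := Classical.epsilon (Q.IsCosineSolution e z)

/-- the derivative `s'(·; z)` on an edge -/
def s' (Q : RashbaNetwork) (e : Q.Edge) (z : ℂ) : ℝ → ℂ := segDeriv (Q.len e) (Q.s e z)

/-- The state space: the Hilbert direct sum of `L²([0, l], ℂ²)` over all edges. -/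
abbrev StateSpace (Q : RashbaNetwork) : Type :=
  lp (fun e : Q.Edge => Lp Spinor 2 (Q.edgeMeasure e)) 2

/-- The family of functions `f` represents the state `u`. -/
def Represents (Q : RashbaNetwork) (f : Q.Edge → ℝ → Spinor) (u : Q.StateSpace) : Prop :=
  ∀ e, (u e : ℝ → Spinor) =ᵐ[Q.edgeMeasure e] f e

/-- `f` belongs to the state space `L²` of the graph. -/
def SquareIntegrable (Q : RashbaNetwork) (f : Q.Edge → ℝ → Spinor) : Prop :=
  ∃ u : Q.StateSpace, Q.Represents f u

lemma len_pos (Q : RashbaNetwork) (e : Q.Edge) : 0 < Q.len e := by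
  obtain ⟨a, b, ha, h⟩ := Q.length_bounds
  exact ha.trans_le (h e.1 e.2).1

lemma finite_outEdges (Q : RashbaNetwork) (α : Q.Vertex) : (Q.outEdges α).Finite := by
  obtain ⟨N, h⟩ := Q.degree_bounds
  have h1 : {e ∈ Q.edges | e.1 = α.1}.Finite := by
    refine Set.encard_lt_top_iff.1 (lt_of_le_of_lt (le_self_add.trans (h α.1 α.2).2) ?_)
    exact ENat.natCast_lt_top N
  refine Set.Finite.of_finite_image (f := Subtype.val) (h1.subset ?_) Subtype.val_injective.injOn
  rintro _ ⟨e, he, rfl⟩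
  exact ⟨e.2, congrArg Subtype.val he⟩

lemma finite_inEdges (Q : RashbaNetwork) (α : Q.Vertex) : (Q.inEdges α).Finite := by
  obtain ⟨N, h⟩ := Q.degree_bounds
  have h1 : {e ∈ Q.edges | e.2 = α.1}.Finite := by
    refine Set.encard_lt_top_iff.1 (lt_of_le_of_lt (le_add_self.trans (h α.1 α.2).2) ?_)
    exact ENat.natCast_lt_top N
  refine Set.Finite.of_finite_image (f := Subtype.val) (h1.subset ?_) Subtype.val_injective.injOn
  rintro _ ⟨e, he, rfl⟩
  exact ⟨e.2, congrArg Subtype.val he⟩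

end RashbaNetwork

section segment

variable {F : Type*} [NormedAddCommGroup F] [NormedSpace ℝ F] {l : ℝ}

lemma segDeriv_add {f g : ℝ → F} {t : ℝ} (hf : DifferentiableWithinAt ℝ f (Icc 0 l) t)
    (hg : DifferentiableWithinAt ℝ g (Icc 0 l) t) :
    segDeriv l (f + g) t = segDeriv l f t + segDeriv l g t := derivWithin_add hf hg

lemma segDeriv_smul [NormedSpace ℂ F] [IsScalarTower ℝ ℂ F] {f : ℝ → F} {t : ℝ} (k : ℂ)
    (hf : DifferentiableWithinAt ℝ f (Icc 0 l) t) :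
    segDeriv l (k • f) t = k • segDeriv l f t := derivWithin_const_smul k hf

lemma segDeriv_congr {f g : ℝ → F} (h : EqOn f g (Icc 0 l)) :
    EqOn (segDeriv l f) (segDeriv l g) (Icc 0 l) :=
  fun _ ht => derivWithin_congr h (h ht)

lemma intervalIntegrable_of_memLp {F : Type*} [NormedAddCommGroup F] {l : ℝ} {g : ℝ → F} (hg : MemLp g 2 (volume.restrict (Icc 0 l)))
    {t : ℝ} (ht : t ∈ Icc 0 l) : IntervalIntegrable g volume 0 t := by
  have h : IntegrableOn g (Icc 0 l) := hg.integrable (by norm_num)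
  rw [intervalIntegrable_iff, uIoc_of_le ht.1]
  exact h.mono_set fun x hx => ⟨hx.1.le, hx.2.trans ht.2⟩

lemma MemH2.add {f g : ℝ → F} (hf : MemH2 l f) (hg : MemH2 l g) : MemH2 l (f + g) := by
  refine ⟨hf.1.add hg.1, ?_⟩
  obtain ⟨f2, hf2, hf'⟩ := hf.2
  obtain ⟨g2, hg2, hg'⟩ := hg.2
  refine ⟨f2 + g2, hf2.add hg2, fun t ht => ?_⟩
  have h0 : (0 : ℝ) ∈ Icc 0 l := ⟨le_rfl, ht.1.trans ht.2⟩
  have hint : (∫ s in (0 : ℝ)..t, (f2 + g2) s) =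
      (∫ s in (0 : ℝ)..t, f2 s) + ∫ s in (0 : ℝ)..t, g2 s :=
    intervalIntegral.integral_add (intervalIntegrable_of_memLp hf2 ht)
      (intervalIntegrable_of_memLp hg2 ht)
  rw [segDeriv_add (hf.1 t ht) (hg.1 t ht), segDeriv_add (hf.1 0 h0) (hg.1 0 h0), hf' t ht,
    hg' t ht, hint]
  abel

lemma MemH2.smul [NormedSpace ℂ F] [IsScalarTower ℝ ℂ F] {f : ℝ → F} (k : ℂ) (hf : MemH2 l f) :
    MemH2 l (k • f) := by
  refine ⟨hf.1.const_smul k, ?_⟩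
  obtain ⟨f2, hf2, hf'⟩ := hf.2
  refine ⟨k • f2, hf2.const_smul k, fun t ht => ?_⟩
  have h0 : (0 : ℝ) ∈ Icc 0 l := ⟨le_rfl, ht.1.trans ht.2⟩
  rw [segDeriv_smul k (hf.1 t ht), segDeriv_smul k (hf.1 0 h0), hf' t ht, smul_add,
    ← intervalIntegral.integral_smul]
  rfl

lemma MemH2.zero : MemH2 l (0 : ℝ → F) := by
  have h : segDeriv l (0 : ℝ → F) = 0 := by
    funext t
    exact congrFun (derivWithin_const (s := Icc 0 l) (c := (0 : F))) t
  refine ⟨differentiableOn_const 0, 0, MemLp.zero, fun t _ => ?_⟩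
  simp [h]

lemma MemH2.ae_differentiable [CompleteSpace F] {f : ℝ → F} (hf : MemH2 l f) :
    ∀ᵐ t ∂(volume.restrict (Icc 0 l)), DifferentiableWithinAt ℝ (segDeriv l f) (Icc 0 l) t := by
  obtain ⟨g, hg, h⟩ := hf.2
  rw [ae_restrict_iff' measurableSet_Icc]
  rcases le_or_gt 0 l with hl | hl
  · have hi := intervalIntegrable_of_memLp hg (t := l) ⟨hl, le_rfl⟩
    filter_upwards [hi.ae_hasDerivAt_integral] with t ht hmem
    rw [uIcc_of_le hl] at ht
    have h1 := (ht hmem 0 ⟨le_rfl, hl⟩).differentiableAt.differentiableWithinAt (s := Icc 0 l)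
    exact (h1.const_add (segDeriv l f 0)).congr h (h t hmem)
  · refine Filter.Eventually.of_forall fun t ht => ?_
    exact absurd (ht.1.trans ht.2) (not_le.2 hl)

end segment

namespace RashbaNetwork

lemma differentiable_gauge_apply (Q : RashbaNetwork) (e : Q.Edge) {f : ℝ → Spinor} {t : ℝ}
    (hf : DifferentiableWithinAt ℝ f (Icc 0 (Q.len e)) t) :
    DifferentiableWithinAt ℝ (fun t => Q.gauge e t (f t)) (Icc 0 (Q.len e)) t := by
  have hA : Differentiable ℝ Q.A := Q.contDiff_A.differentiable one_ne_zero
  have ha : Differentiable ℝ (Q.a e) := by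
    have h : Differentiable ℝ fun t : ℝ => Q.A (e.1.1 + t • Q.dir e) :=
      hA.comp ((differentiable_const _).add (differentiable_id.smul_const _))
    exact h.inner ℝ (differentiable_const _)
  have ha' : DifferentiableWithinAt ℝ (fun t => ((Q.a e t : ℝ) : ℂ)) (Icc 0 (Q.len e)) t :=
    (Complex.ofRealCLM.differentiable.comp ha).differentiableAt.differentiableWithinAt
  have hσ : DifferentiableWithinAt ℝ (fun t => (Q.kR : ℂ) • Q.σ e (f t)) (Icc 0 (Q.len e)) t :=
    ((((Q.σ e).restrictScalars ℝ).differentiableAt).comp_differentiableWithinAt t hf).const_smul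
      (Q.kR : ℂ)
  exact (ha'.smul hf).add hσ

lemma momentum_add (Q : RashbaNetwork) (e : Q.Edge) {f g : ℝ → Spinor} {t : ℝ}
    (hf : DifferentiableWithinAt ℝ f (Icc 0 (Q.len e)) t)
    (hg : DifferentiableWithinAt ℝ g (Icc 0 (Q.len e)) t) :
    Q.momentum e (f + g) t = Q.momentum e f t + Q.momentum e g t := by
  simp only [momentum, segDeriv_add hf hg, Pi.add_apply, map_add, smul_add]
  abel

lemma momentum_smul (Q : RashbaNetwork) (e : Q.Edge) {f : ℝ → Spinor} {t : ℝ} (k : ℂ)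
    (hf : DifferentiableWithinAt ℝ f (Icc 0 (Q.len e)) t) :
    Q.momentum e (k • f) t = k • Q.momentum e f t := by
  simp only [momentum, segDeriv_smul k hf, Pi.smul_apply, map_smul, smul_add,
    smul_comm Complex.I k]

lemma momentum_congr (Q : RashbaNetwork) (e : Q.Edge) {f g : ℝ → Spinor}
    (h : EqOn f g (Icc 0 (Q.len e))) :
    EqOn (Q.momentum e f) (Q.momentum e g) (Icc 0 (Q.len e)) := fun t ht => by
  simp only [momentum, segDeriv_congr h ht, h ht]

lemma edgeOp_congr (Q : RashbaNetwork) (e : Q.Edge) {f g : ℝ → Spinor}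
    (h : EqOn f g (Icc 0 (Q.len e))) :
    EqOn (Q.edgeOp e f) (Q.edgeOp e g) (Icc 0 (Q.len e)) := fun t ht => by
  simp only [edgeOp, Q.momentum_congr e (Q.momentum_congr e h) ht, h ht]

lemma ae_differentiable_momentum (Q : RashbaNetwork) (e : Q.Edge) {f : ℝ → Spinor}
    (hf : MemH2 (Q.len e) f) : ∀ᵐ t ∂(Q.edgeMeasure e), t ∈ Icc 0 (Q.len e) ∧
      DifferentiableWithinAt ℝ (Q.momentum e f) (Icc 0 (Q.len e)) t := by
  filter_upwards [hf.ae_differentiable, ae_restrict_mem measurableSet_Icc] with t ht hmem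
  exact ⟨hmem, (ht.const_smul Complex.I).add (Q.differentiable_gauge_apply e (hf.1 t hmem))⟩

lemma edgeOp_add (Q : RashbaNetwork) (e : Q.Edge) {f g : ℝ → Spinor}
    (hf : MemH2 (Q.len e) f) (hg : MemH2 (Q.len e) g) :
    Q.edgeOp e (f + g) =ᵐ[Q.edgeMeasure e] Q.edgeOp e f + Q.edgeOp e g := by
  filter_upwards [Q.ae_differentiable_momentum e hf, Q.ae_differentiable_momentum e hg] with t h1 h2
  have h : EqOn (Q.momentum e (f + g)) (Q.momentum e f + Q.momentum e g) (Icc 0 (Q.len e)) :=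
    fun r hr => Q.momentum_add e (hf.1 r hr) (hg.1 r hr)
  simp only [edgeOp, Q.momentum_congr e h h1.1, Q.momentum_add e h1.2 h2.2, Pi.add_apply, smul_add]
  abel

lemma edgeOp_smul (Q : RashbaNetwork) (e : Q.Edge) {f : ℝ → Spinor} (k : ℂ)
    (hf : MemH2 (Q.len e) f) :
    Q.edgeOp e (k • f) =ᵐ[Q.edgeMeasure e] k • Q.edgeOp e f := by
  filter_upwards [Q.ae_differentiable_momentum e hf] with t h1
  have h : EqOn (Q.momentum e (k • f)) (k • Q.momentum e f) (Icc 0 (Q.len e)) :=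
    fun r hr => Q.momentum_smul e k (hf.1 r hr)
  simp only [edgeOp, Q.momentum_congr e h h1.1, Q.momentum_smul e k h1.2, Pi.smul_apply, smul_add]
  rw [smul_comm]

lemma edgeOp_zero (Q : RashbaNetwork) (e : Q.Edge) : Q.edgeOp e 0 =ᵐ[Q.edgeMeasure e] 0 := by
  have h := Q.edgeOp_smul e 0 (MemH2.zero (l := Q.len e) (F := Spinor))
  simpa using h

lemma Represents.add {Q : RashbaNetwork} {f g : Q.Edge → ℝ → Spinor} {u v : Q.StateSpace}
    (hf : Q.Represents f u) (hg : Q.Represents g v) : Q.Represents (f + g) (u + v) := fun e =>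
  (Lp.coeFn_add (u e) (v e)).trans ((hf e).add (hg e))

lemma Represents.smul {Q : RashbaNetwork} {f : Q.Edge → ℝ → Spinor} {u : Q.StateSpace} (k : ℂ)
    (hf : Q.Represents f u) : Q.Represents (k • f) (k • u) := fun e =>
  (Lp.coeFn_smul k (u e)).trans ((hf e).const_smul k)

lemma represents_zero (Q : RashbaNetwork) : Q.Represents 0 0 := fun e =>
  Lp.coeFn_zero Spinor 2 (Q.edgeMeasure e)

/-- The graph of the maximal operator: all pairs `(u, v)` in the state space such that each component
of `u` is in `H²` of its edge and `v` is the image of `u` under the differential expressions. -/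
def maximalGraph (Q : RashbaNetwork) : Submodule ℂ (Q.StateSpace × Q.StateSpace) where
  carrier := {w | ∃ f : Q.Edge → ℝ → Spinor, (∀ e, MemH2 (Q.len e) (f e)) ∧
    Q.Represents f w.1 ∧ Q.Represents (fun e => Q.edgeOp e (f e)) w.2}
  add_mem' := by
    rintro w w' ⟨f, hf, h1, h2⟩ ⟨g, hg, h3, h4⟩
    exact ⟨f + g, fun e => (hf e).add (hg e), h1.add h3,
      fun e => ((h2.add h4) e).trans (Q.edgeOp_add e (hf e) (hg e)).symm⟩
  zero_mem' := ⟨0, fun _ => MemH2.zero, Q.represents_zero,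
    fun e => (Q.represents_zero e).trans (Q.edgeOp_zero e).symm⟩
  smul_mem' := by
    rintro k w ⟨f, hf, h1, h2⟩
    exact ⟨k • f, fun e => (hf e).smul k, h1.smul k,
      fun e => ((h2.smul k) e).trans (Q.edgeOp_smul e k (hf e)).symm⟩

lemma eqOn_of_represents (Q : RashbaNetwork) {f g : Q.Edge → ℝ → Spinor} {u : Q.StateSpace}
    (hf : ∀ e, MemH2 (Q.len e) (f e)) (hg : ∀ e, MemH2 (Q.len e) (g e))
    (h1 : Q.Represents f u) (h2 : Q.Represents g u) (e : Q.Edge) :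
    EqOn (f e) (g e) (Icc 0 (Q.len e)) :=
  Measure.eqOn_Icc_of_ae_eq volume (Q.len_pos e).ne ((h1 e).symm.trans (h2 e))
    (hf e).1.continuousOn (hg e).1.continuousOn

/-- The maximal graph is the graph of an operator. -/
lemma maximalGraph_single_valued (Q : RashbaNetwork) (w : Q.StateSpace × Q.StateSpace)
    (hw : w ∈ Q.maximalGraph) (h0 : w.1 = 0) : w.2 = 0 := by
  obtain ⟨f, hf, h1, h2⟩ := hw
  rw [h0] at h1
  refine lp.ext (funext fun e => Lp.ext ?_)
  have hEq := Q.edgeOp_congr e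
    (Q.eqOn_of_represents hf (fun _ => MemH2.zero) h1 Q.represents_zero e)
  have h3 : Q.edgeOp e (f e) =ᵐ[Q.edgeMeasure e] Q.edgeOp e 0 := by
    filter_upwards [ae_restrict_mem measurableSet_Icc] with t ht
    exact hEq ht
  exact ((h2 e).trans (h3.trans (Q.edgeOp_zero e))).trans (Q.represents_zero e).symm

/-- The maximal operator: it acts by the differential expressions on all states `u` whose components
are in `H²` of their edges and whose image is again square integrable. -/
def maximalOp (Q : RashbaNetwork) : Q.StateSpace →ₗ.[ℂ] Q.StateSpace := Q.maximalGraph.toLinearPMap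

lemma graph_maximalOp (Q : RashbaNetwork) : Q.maximalOp.graph = Q.maximalGraph :=
  Submodule.toLinearPMap_graph_eq _ Q.maximalGraph_single_valued

/-- The states with `H²` components that vanish at both ends of each edge. -/
def dirichletDomain (Q : RashbaNetwork) : Submodule ℂ Q.StateSpace where
  carrier := {u | ∃ f : Q.Edge → ℝ → Spinor, (∀ e, MemH2 (Q.len e) (f e)) ∧ Q.Represents f u ∧
    ∀ e, f e 0 = 0 ∧ f e (Q.len e) = 0}
  add_mem' := by
    rintro u v ⟨f, hf, h1, h2⟩ ⟨g, hg, h3, h4⟩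
    exact ⟨f + g, fun e => (hf e).add (hg e), h1.add h3,
      fun e => by simp [(h2 e).1, (h2 e).2, (h4 e).1, (h4 e).2]⟩
  zero_mem' := ⟨0, fun _ => MemH2.zero, Q.represents_zero, fun _ => ⟨rfl, rfl⟩⟩
  smul_mem' := by
    rintro k u ⟨f, hf, h1, h2⟩
    exact ⟨k • f, fun e => (hf e).smul k, h1.smul k, fun e => by simp [(h2 e).1, (h2 e).2]⟩

/-- The Dirichlet operator `D`. -/
def dirichletOp (Q : RashbaNetwork) : Q.StateSpace →ₗ.[ℂ] Q.StateSpace :=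
  Q.maximalOp.domRestrict Q.dirichletDomain

lemma left_mem (Q : RashbaNetwork) (e : Q.Edge) : (0 : ℝ) ∈ Icc 0 (Q.len e) :=
  ⟨le_rfl, (Q.len_pos e).le⟩

lemma right_mem (Q : RashbaNetwork) (e : Q.Edge) : Q.len e ∈ Icc 0 (Q.len e) :=
  ⟨(Q.len_pos e).le, le_rfl⟩

lemma covDeriv_add (Q : RashbaNetwork) (e : Q.Edge) {f g : ℝ → Spinor} {t : ℝ}
    (hf : MemH2 (Q.len e) f) (hg : MemH2 (Q.len e) g) (ht : t ∈ Icc 0 (Q.len e)) :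
    Q.covDeriv e (f + g) t = Q.covDeriv e f t + Q.covDeriv e g t := by
  simp only [covDeriv, segDeriv_add (hf.1 t ht) (hg.1 t ht), Pi.add_apply, map_add, smul_add]
  abel

lemma covDeriv_smul (Q : RashbaNetwork) (e : Q.Edge) {f : ℝ → Spinor} {t : ℝ} (k : ℂ)
    (hf : MemH2 (Q.len e) f) (ht : t ∈ Icc 0 (Q.len e)) :
    Q.covDeriv e (k • f) t = k • Q.covDeriv e f t := by
  simp only [covDeriv, segDeriv_smul k (hf.1 t ht), Pi.smul_apply, map_smul, smul_sub,
    smul_comm Complex.I k]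

lemma flux_add (Q : RashbaNetwork) {f g : Q.Edge → ℝ → Spinor}
    (hf : ∀ e, MemH2 (Q.len e) (f e)) (hg : ∀ e, MemH2 (Q.len e) (g e)) (α : Q.Vertex) :
    Q.flux (f + g) α = Q.flux f α + Q.flux g α := by
  simp only [flux, Pi.add_apply, fun e => Q.covDeriv_add e (hf e) (hg e) (Q.left_mem e),
    fun e => Q.covDeriv_add e (hf e) (hg e) (Q.right_mem e),
    finsum_mem_add_distrib (Q.finite_outEdges α), finsum_mem_add_distrib (Q.finite_inEdges α)]
  abel

lemma flux_smul (Q : RashbaNetwork) {f : Q.Edge → ℝ → Spinor} (k : ℂ)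
    (hf : ∀ e, MemH2 (Q.len e) (f e)) (α : Q.Vertex) :
    Q.flux (k • f) α = k • Q.flux f α := by
  simp only [flux, Pi.smul_apply, fun e => Q.covDeriv_smul e k (hf e) (Q.left_mem e),
    fun e => Q.covDeriv_smul e k (hf e) (Q.right_mem e), smul_sub,
    smul_finsum_mem (Q.finite_outEdges α), smul_finsum_mem (Q.finite_inEdges α)]

/-- The states with `H²` components that are continuous at all vertices, with vertex values `ξ`, and
satisfy the coupling condition `f'(α) = ε(α) ξ(α)` at each vertex `α`. -/
def hamiltonianDomain (Q : RashbaNetwork) : Submodule ℂ Q.StateSpace where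
  carrier := {u | ∃ (f : Q.Edge → ℝ → Spinor) (ξ : Q.Vertex → Spinor),
    (∀ e, MemH2 (Q.len e) (f e)) ∧ Q.Represents f u ∧ Q.HasVertexValues f ξ ∧
    ∀ α, Q.flux f α = (Q.ε α : ℂ) • ξ α}
  add_mem' := by
    rintro u v ⟨f, ξ, hf, h1, h2, h3⟩ ⟨g, η, hg, h4, h5, h6⟩
    refine ⟨f + g, ξ + η, fun e => (hf e).add (hg e), h1.add h4, fun e => ?_, fun α => ?_⟩
    · simp [(h2 e).1, (h2 e).2, (h5 e).1, (h5 e).2]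
    · rw [Q.flux_add hf hg, h3, h6, Pi.add_apply, smul_add]
  zero_mem' := by
    refine ⟨0, 0, fun _ => MemH2.zero, Q.represents_zero, fun _ => ⟨rfl, rfl⟩, fun α => ?_⟩
    have h := Q.flux_smul (f := 0) 0 (fun _ => MemH2.zero) α
    simpa using h
  smul_mem' := by
    rintro k u ⟨f, ξ, hf, h1, h2, h3⟩
    refine ⟨k • f, k • ξ, fun e => (hf e).smul k, h1.smul k, fun e => ?_, fun α => ?_⟩
    · simp [(h2 e).1, (h2 e).2]
    · rw [Q.flux_smul k hf, h3, Pi.smul_apply, smul_comm]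

/-- The Hamiltonian `L`. -/
def hamiltonian (Q : RashbaNetwork) : Q.StateSpace →ₗ.[ℂ] Q.StateSpace :=
  Q.maximalOp.domRestrict Q.hamiltonianDomain

/-- `f` is an eigenfunction of `L` with eigenvalue `E`: it represents a nonzero vector `u` of the
domain of `L` with `L u = E u`. -/
def IsEigenfunction (Q : RashbaNetwork) (E : ℂ) (f : Q.Edge → ℝ → Spinor) : Prop :=
  ∃ u : Q.hamiltonian.domain, (u : Q.StateSpace) ≠ 0 ∧ Q.Represents f u ∧
    Q.hamiltonian u = E • (u : Q.StateSpace)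

end RashbaNetwork

/-- The spectrum of an unbounded operator `T`: all `z` such that `T - z` does not have a bounded
everywhere defined inverse `R`. -/
def LinearPMap.unboundedSpectrum {H : Type*} [NormedAddCommGroup H] [NormedSpace ℂ H]
    (T : H →ₗ.[ℂ] H) : Set ℂ :=
  {z | ¬ ∃ R : H →L[ℂ] H,
    (∀ x : T.domain, R (T x - z • (x : H)) = x) ∧
    ∀ h : H, ∃ x : T.domain, (x : H) = R h ∧ T x - z • (x : H) = h}

end

/-!
Multiplication by the unitary matrices `Θ*` turns `L f = E f` on an edge into Hill's equation
`y'' = (U - z) y`, the derivative in the vertex condition into `y'`, and leaves absolute values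
alone. Where `s(l) ≠ 0`, a solution is the combination of `s` and `c` prescribed by its boundary
values, which is formula 1; differentiating it at the two ends and using `c s' - c' s = 1` gives
formula 2.

That `E` is not in the spectrum of `D` is used through the resolvent of `D`, applied to states
supported on a single edge: the `L²` norm of a solution of the inhomogeneous Dirichlet problem on an
edge is bounded by that of its right-hand side, with a constant independent of the edge. Hence
`s(l) ≠ 0`, and the `L²` norm of any solution on an edge is bounded by its boundary values.
Conversely, Green's identity against `t (1 - t / l)²`, which vanishes at both ends and whose
derivative is `1` at `0` and `0` at `l`, bounds `f 0` by the `L²` norms of `f` and `U - z`, and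
reflecting the edge bounds `f l`. These estimates are uniform over the edges, and since
the degrees of the vertices lie between `1` and `N`, summing their squares over the edges compares
the norm of `f` in `𝓗` with that of its vertex values in `ℓ²`.
-/

section Primitive

variable {E F G : Type*} [NormedAddCommGroup E] [NormedSpace ℝ E] [NormedAddCommGroup F]
  [NormedSpace ℝ F] [NormedAddCommGroup G] [NormedSpace ℝ G] {a b : ℝ}

/-- `F` is absolutely continuous on the interval `uIcc a b`, with derivative `f` almost everywhere
there, and `f` is integrable. Only the values of `F` on `uIcc a b` matter. -/
structure IsPrimitiveOn (F f : ℝ → E) (a b : ℝ) : Prop where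
  absolutelyContinuous : AbsolutelyContinuousOnInterval F a b
  intervalIntegrable : IntervalIntegrable f volume a b
  ae_hasDerivAt : ∀ᵐ t, t ∈ uIcc a b → HasDerivAt F (f t) t

lemma absolutelyContinuousOnInterval_of_dist_le {X Y Z : Type*} [PseudoMetricSpace X]
    [PseudoMetricSpace Y] [PseudoMetricSpace Z] {f : ℝ → X} {g : ℝ → Y} {h : ℝ → Z} {C D : ℝ}
    (hg : AbsolutelyContinuousOnInterval g a b) (hh : AbsolutelyContinuousOnInterval h a b)
    (hf : ∀ s ∈ uIcc a b, ∀ t ∈ uIcc a b,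
      dist (f s) (f t) ≤ C * dist (g s) (g t) + D * dist (h s) (h t)) :
    AbsolutelyContinuousOnInterval f a b := by
  unfold AbsolutelyContinuousOnInterval at hg hh
  refine squeeze_zero' (.of_forall fun _ => Finset.sum_nonneg fun _ _ => dist_nonneg) ?_
    (by simpa using (hg.const_mul C).add (hh.const_mul D))
  rw [Filter.eventually_inf_principal]
  filter_upwards with I hI
  simp only [Finset.mul_sum, ← Finset.sum_add_distrib]
  exact Finset.sum_le_sum fun i hi => hf _ (hI.1 i hi).1 _ (hI.1 i hi).2

lemma absolutelyContinuousOnInterval_integral {f : ℝ → E} (hf : IntervalIntegrable f volume a b) :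
    AbsolutelyContinuousOnInterval (fun t => ∫ s in a..t, f s) a b := by
  have hnorm := hf.norm.absolutelyContinuousOnInterval_intervalIntegral (left_mem_uIcc (b := b))
  refine absolutelyContinuousOnInterval_of_dist_le (C := 1) (D := 0) hnorm hnorm fun s hs t ht => ?_
  have hint : ∀ r ∈ uIcc a b, IntervalIntegrable f volume a r := fun r hr =>
    hf.mono_set (uIcc_subset_uIcc_left hr)
  rw [dist_eq_norm, dist_eq_norm,
    intervalIntegral.integral_interval_sub_left (hint s hs) (hint t ht),
    intervalIntegral.integral_interval_sub_left (hint s hs).norm (hint t ht).norm]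
  simpa using intervalIntegral.norm_integral_le_abs_integral_norm

lemma ae_mem_nhds_uIcc (a b : ℝ) : ∀ᵐ t, t ∈ uIcc a b → uIcc a b ∈ nhds t := by
  have hne : ∀ c : ℝ, ∀ᵐ t : ℝ, t ≠ c := fun c => by simp [ae_iff, measure_singleton]
  filter_upwards [hne (min a b), hne (max a b)] with t hmin hmax hmem
  exact Icc_mem_nhds (hmem.1.lt_of_ne' hmin) (hmem.2.lt_of_ne hmax)

namespace IsPrimitiveOn

lemma continuousOn {F f : ℝ → E} (hF : IsPrimitiveOn F f a b) : ContinuousOn F (uIcc a b) :=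
  hF.absolutelyContinuous.continuousOn

lemma of_eqOn_add_integral [CompleteSpace E] {F f : ℝ → E} {C : E}
    (hf : IntervalIntegrable f volume a b)
    (hF : ∀ t ∈ uIcc a b, F t = C + ∫ s in a..t, f s) : IsPrimitiveOn F f a b where
  absolutelyContinuous := by
    have hprim := absolutelyContinuousOnInterval_integral hf
    refine absolutelyContinuousOnInterval_of_dist_le (C := 1) (D := 0) hprim hprim
      fun s hs t ht => ?_
    simp [hF s hs, hF t ht]
  intervalIntegrable := hf
  ae_hasDerivAt := by
    filter_upwards [hf.ae_hasDerivAt_integral, ae_mem_nhds_uIcc a b] with t ht hnhds hmem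
    refine ((ht hmem a left_mem_uIcc).const_add C).congr_of_eventuallyEq ?_
    filter_upwards [hnhds hmem] with s hs
    exact hF s hs

lemma eq_of_ae_eq_zero {F f : ℝ → E} (hF : IsPrimitiveOn F f a b)
    (hf : ∀ᵐ t, t ∈ uIcc a b → f t = 0) {t : ℝ} (ht : t ∈ uIcc a b) : F t = F a := by
  obtain ⟨C, hC⟩ := hF.absolutelyContinuous.const_of_ae_hasDerivAt_zero <| by
    filter_upwards [hF.ae_hasDerivAt, hf] with s hs hzero hmem
    exact hzero hmem ▸ hs hmem
  rw [hC t ht, hC a left_mem_uIcc]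

lemma congr_ae {F f g : ℝ → E} (hF : IsPrimitiveOn F f a b)
    (hfg : ∀ᵐ t, t ∈ uIcc a b → f t = g t) : IsPrimitiveOn F g a b where
  absolutelyContinuous := hF.absolutelyContinuous
  intervalIntegrable := hF.intervalIntegrable.congr_ae <|
    (ae_restrict_iff' measurableSet_uIoc).2 <| hfg.mono fun _ ht hmem => ht (uIoc_subset_uIcc hmem)
  ae_hasDerivAt := by
    filter_upwards [hF.ae_hasDerivAt, hfg] with t ht heq hmem
    exact heq hmem ▸ ht hmem

lemma sub {F f H h : ℝ → E} (hF : IsPrimitiveOn F f a b) (hH : IsPrimitiveOn H h a b) :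
    IsPrimitiveOn (F - H) (f - h) a b where
  absolutelyContinuous := hF.absolutelyContinuous.sub hH.absolutelyContinuous
  intervalIntegrable := hF.intervalIntegrable.sub hH.intervalIntegrable
  ae_hasDerivAt := by
    filter_upwards [hF.ae_hasDerivAt, hH.ae_hasDerivAt] with t h1 h2 hmem
    exact (h1 hmem).sub (h2 hmem)

lemma add {F f H h : ℝ → E} (hF : IsPrimitiveOn F f a b) (hH : IsPrimitiveOn H h a b) :
    IsPrimitiveOn (F + H) (f + h) a b where
  absolutelyContinuous := hF.absolutelyContinuous.add hH.absolutelyContinuous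
  intervalIntegrable := hF.intervalIntegrable.add hH.intervalIntegrable
  ae_hasDerivAt := by
    filter_upwards [hF.ae_hasDerivAt, hH.ae_hasDerivAt] with t h1 h2 hmem
    exact (h1 hmem).add (h2 hmem)

lemma eq_add_integral [CompleteSpace E] {F f : ℝ → E} (hF : IsPrimitiveOn F f a b) {t : ℝ}
    (ht : t ∈ uIcc a b) : F t = F a + ∫ s in a..t, f s := by
  have hprim : IsPrimitiveOn (fun t => ∫ s in a..t, f s) f a b :=
    of_eqOn_add_integral (C := 0) hF.intervalIntegrable fun t _ => (zero_add _).symm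
  have hconst := (hF.sub hprim).eq_of_ae_eq_zero (.of_forall fun _ _ => sub_self _) ht
  simpa [sub_eq_iff_eq_add] using hconst

lemma mono {F f : ℝ → E} {c d : ℝ} (hF : IsPrimitiveOn F f a b) (h : uIcc c d ⊆ uIcc a b) :
    IsPrimitiveOn F f c d where
  absolutelyContinuous := hF.absolutelyContinuous.mono h
  intervalIntegrable := hF.intervalIntegrable.mono_set h
  ae_hasDerivAt := hF.ae_hasDerivAt.mono fun _ ht hmem => ht (h hmem)

lemma clm_apply (T : E →L[ℝ] G) {F f : ℝ → E} (hF : IsPrimitiveOn F f a b) :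
    IsPrimitiveOn (fun t => T (F t)) (fun t => T (f t)) a b where
  absolutelyContinuous := absolutelyContinuousOnInterval_of_dist_le (C := ‖T‖) (D := 0)
    hF.absolutelyContinuous hF.absolutelyContinuous fun s _ t _ => by
      simpa [dist_eq_norm, ← map_sub] using T.le_opNorm (F s - F t)
  intervalIntegrable :=
    ⟨T.integrable_comp hF.intervalIntegrable.1, T.integrable_comp hF.intervalIntegrable.2⟩
  ae_hasDerivAt := by
    filter_upwards [hF.ae_hasDerivAt] with t ht hmem
    exact T.hasFDerivAt.comp_hasDerivAt t (ht hmem)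

end IsPrimitiveOn

lemma intervalIntegrable_bilin_of_continuousOn (L : E →L[ℝ] F →L[ℝ] G) {B : ℝ → E} {g : ℝ → F}
    (hB : ContinuousOn B (uIcc a b)) (hg : IntervalIntegrable g volume a b) :
    IntervalIntegrable (fun t => L (B t) (g t)) volume a b := by
  obtain ⟨C, hC⟩ := isCompact_uIcc.exists_bound_of_continuousOn hB
  rw [intervalIntegrable_iff] at hg ⊢
  refine Integrable.mono' (hg.norm.const_mul (‖L‖ * C)) (L.aestronglyMeasurable_comp₂
    ((hB.mono uIoc_subset_uIcc).aestronglyMeasurable measurableSet_uIoc) hg.1) ?_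
  filter_upwards [ae_restrict_mem measurableSet_uIoc] with t ht
  refine (L.le_opNorm₂ _ _).trans ?_
  gcongr
  exact hC t (uIoc_subset_uIcc ht)

lemma IsPrimitiveOn.bilin (L : E →L[ℝ] F →L[ℝ] G) {B B' : ℝ → E} {H H' : ℝ → F}
    (hB : IsPrimitiveOn B B' a b) (hH : IsPrimitiveOn H H' a b) :
    IsPrimitiveOn (fun t => L (B t) (H t)) (fun t => L (B t) (H' t) + L (B' t) (H t)) a b where
  absolutelyContinuous := by
    obtain ⟨C, hC⟩ := hB.absolutelyContinuous.exists_bound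
    obtain ⟨D, hD⟩ := hH.absolutelyContinuous.exists_bound
    refine absolutelyContinuousOnInterval_of_dist_le (C := ‖L‖ * D) (D := ‖L‖ * C)
      hB.absolutelyContinuous hH.absolutelyContinuous fun s hs t ht => ?_
    simp only [dist_eq_norm]
    calc ‖L (B s) (H s) - L (B t) (H t)‖ = ‖L (B s - B t) (H s) + L (B t) (H s - H t)‖ := by simp
      _ ≤ ‖L‖ * ‖B s - B t‖ * ‖H s‖ + ‖L‖ * ‖B t‖ * ‖H s - H t‖ :=
          norm_add_le_of_le (L.le_opNorm₂ _ _) (L.le_opNorm₂ _ _)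
      _ ≤ ‖L‖ * ‖B s - B t‖ * D + ‖L‖ * C * ‖H s - H t‖ := by
          gcongr
          exacts [hD s hs, hC t ht]
      _ = ‖L‖ * D * ‖B s - B t‖ + ‖L‖ * C * ‖H s - H t‖ := by ring
  intervalIntegrable :=
    (intervalIntegrable_bilin_of_continuousOn L hB.continuousOn hH.intervalIntegrable).add
      (intervalIntegrable_bilin_of_continuousOn L.flip hH.continuousOn hB.intervalIntegrable)
  ae_hasDerivAt := by
    filter_upwards [hB.ae_hasDerivAt, hH.ae_hasDerivAt] with t h1 h2 hmem
    exact L.hasDerivAt_of_bilinear (fun _ => h1 hmem) fun _ => h2 hmem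

lemma IsPrimitiveOn.of_hasDerivWithinAt {F f : ℝ → E}
    (hF : ∀ t ∈ uIcc a b, HasDerivWithinAt F (f t) (uIcc a b) t)
    (hf : ContinuousOn f (uIcc a b)) : IsPrimitiveOn F f a b where
  absolutelyContinuous := by
    obtain ⟨C, hC⟩ := isCompact_uIcc.exists_bound_of_continuousOn hf
    refine ((convex_uIcc a b).lipschitzOnWith_of_nnnorm_hasDerivWithin_le (C := C.toNNReal) hF
      fun t ht => ?_).absolutelyContinuousOnInterval
    exact NNReal.coe_le_coe.1 ((hC t ht).trans C.le_coe_toNNReal)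
  intervalIntegrable := hf.intervalIntegrable
  ae_hasDerivAt := by
    filter_upwards [ae_mem_nhds_uIcc a b] with t hnhds hmem
    exact (hF t hmem).hasDerivAt (hnhds hmem)

lemma IsPrimitiveOn.hasDerivWithinAt [CompleteSpace E] {F f : ℝ → E} (hab : a ≤ b)
    (hF : IsPrimitiveOn F f a b) (hf : ContinuousOn f (Icc a b)) {t : ℝ} (ht : t ∈ Icc a b) :
    HasDerivWithinAt F (f t) (Icc a b) t := by
  have : Fact (t ∈ Icc a b) := ⟨ht⟩
  rw [← uIcc_of_le hab] at ht
  have hint := hF.intervalIntegrable.mono_set (uIcc_subset_uIcc_left ht)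
  have hderiv := intervalIntegral.integral_hasDerivWithinAt_right (s := Icc a b) (t := Icc a b)
    hint (hf.stronglyMeasurableAtFilter_nhdsWithin measurableSet_Icc t)
    (hf t Fact.out)
  refine (hderiv.const_add (F a)).congr (fun s hs => hF.eq_add_integral ?_) (hF.eq_add_integral ht)
  rwa [uIcc_of_le hab]

end Primitive

section LinearODE

variable {X : Type*} [NormedAddCommGroup X] [NormedSpace ℝ X] {l : ℝ} {A : ℝ → X →L[ℝ] X}

lemma IsPrimitiveOn.pow_succ {F f : ℝ → ℝ} {a b : ℝ} (hF : IsPrimitiveOn F f a b) (n : ℕ) :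
    IsPrimitiveOn (fun t => F t ^ (n + 1)) (fun t => (n + 1) * (F t ^ n * f t)) a b := by
  induction n with
  | zero => simpa using hF
  | succ n ih =>
    convert ih.bilin (ContinuousLinearMap.mul ℝ ℝ) hF using 2 with t t
    · exact _root_.pow_succ _ _
    · simp only [ContinuousLinearMap.mul_apply']
      push_cast
      ring

lemma IsPrimitiveOn.integral_pow_div_factorial_mul {F f : ℝ → ℝ} {a b : ℝ}
    (hF : IsPrimitiveOn F f a b) (hFa : F a = 0) (n : ℕ) :
    ∫ t in a..b, F t ^ n / n.factorial * f t = F b ^ (n + 1) / (n + 1).factorial := by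
  have hpow := (hF.pow_succ n).eq_add_integral right_mem_uIcc
  rw [intervalIntegral.integral_const_mul, hFa, zero_pow n.succ_ne_zero, zero_add] at hpow
  simp only [div_mul_eq_mul_div, intervalIntegral.integral_div, hpow, Nat.factorial_succ,
    Nat.cast_mul, Nat.cast_succ]
  exact (mul_div_mul_left _ _ n.cast_add_one_ne_zero).symm

lemma intervalIntegrable_clm_apply_IccExtend (hl : 0 ≤ l) (hA : IntervalIntegrable A volume 0 l)
    (u : C(Icc 0 l, X)) {t : ℝ} (ht : t ∈ Icc 0 l) :
    IntervalIntegrable (fun r => A r (IccExtend hl u r)) volume 0 t :=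
  intervalIntegrable_bilin_of_continuousOn (ContinuousLinearMap.id ℝ (X →L[ℝ] X)).flip
    u.continuous.Icc_extend'.continuousOn <|
      hA.mono_set (uIcc_subset_uIcc_left (by rwa [uIcc_of_le hl]))

lemma norm_integral_clm_apply_IccExtend_le (hl : 0 ≤ l) (hA : IntervalIntegrable A volume 0 l)
    (u : C(Icc 0 l, X)) {t : ℝ} (ht : t ∈ Icc 0 l) {w : ℝ → ℝ}
    (hw : ContinuousOn w (Icc 0 l)) (huw : ∀ r : Icc 0 l, ‖u r‖ ≤ w r) :
    ‖∫ r in (0 : ℝ)..t, A r (IccExtend hl u r)‖ ≤ ∫ r in (0 : ℝ)..t, w r * ‖A r‖ := by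
  have hsub : Icc 0 t ⊆ Icc 0 l := Icc_subset_Icc_right ht.2
  refine intervalIntegral.norm_integral_le_of_norm_le ht.1 (.of_forall fun r hr => ?_) ?_
  · have hr' := hsub (Ioc_subset_Icc_self hr)
    rw [IccExtend_of_mem hl _ hr', mul_comm]
    exact (A r).le_opNorm_of_le (huw ⟨r, hr'⟩)
  · rw [← uIcc_of_le ht.1] at hsub
    exact (hA.norm.mono_set (hsub.trans Icc_subset_uIcc)).continuousOn_mul (hw.mono hsub)

lemma integral_norm_le_integral_norm_of_mem_Icc {E : Type*} [NormedAddCommGroup E] {A : ℝ → E}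
    (hA : IntervalIntegrable A volume 0 l) {t : ℝ} (ht : t ∈ Icc 0 l) :
    ∫ r in (0 : ℝ)..t, ‖A r‖ ≤ ∫ r in (0 : ℝ)..l, ‖A r‖ :=
  intervalIntegral.integral_mono_interval le_rfl ht.1 ht.2
    (.of_forall fun _ => norm_nonneg _) hA.norm

/-- The Volterra operator `u ↦ (t ↦ ∫ r in 0..t, A r (u r))` on the continuous functions on
`[0, l]`. -/
noncomputable def volterraCLM (hl : 0 ≤ l) (hA : IntervalIntegrable A volume 0 l) :
    C(Icc 0 l, X) →L[ℝ] C(Icc 0 l, X) :=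
  LinearMap.mkContinuous (C := ∫ r in (0 : ℝ)..l, ‖A r‖)
    { toFun u := ⟨fun t => ∫ r in (0 : ℝ)..t, A r (IccExtend hl u r), by
        have hint := intervalIntegrable_clm_apply_IccExtend hl hA u ⟨hl, le_rfl⟩
        have hcont := (absolutelyContinuousOnInterval_integral hint).continuousOn
        rw [uIcc_of_le hl] at hcont
        exact hcont.domRestrict⟩
      map_add' u v := by
        ext t
        simpa [IccExtend] using intervalIntegral.integral_add
          (intervalIntegrable_clm_apply_IccExtend hl hA u t.2)
          (intervalIntegrable_clm_apply_IccExtend hl hA v t.2)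
      map_smul' k u := by
        ext t
        simp [IccExtend] }
    fun u => by
      have hnonneg : 0 ≤ ∫ r in (0 : ℝ)..l, ‖A r‖ :=
        intervalIntegral.integral_nonneg hl fun _ _ => norm_nonneg _
      refine (ContinuousMap.norm_le _ (by positivity)).2 fun t => ?_
      refine (norm_integral_clm_apply_IccExtend_le hl hA u t.2 continuousOn_const
        u.norm_coe_le_norm).trans ?_
      rw [intervalIntegral.integral_const_mul, mul_comm]
      gcongr
      exact integral_norm_le_integral_norm_of_mem_Icc hA t.2

lemma volterraCLM_apply (hl : 0 ≤ l) (hA : IntervalIntegrable A volume 0 l) (u : C(Icc 0 l, X))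
    (t : Icc 0 l) :
    volterraCLM hl hA u t = ∫ r in (0 : ℝ)..t, A r (IccExtend hl u r) := rfl

lemma norm_volterraCLM_pow_apply_le (hl : 0 ≤ l) (hA : IntervalIntegrable A volume 0 l)
    (u : C(Icc 0 l, X)) (n : ℕ) (t : Icc 0 l) :
    ‖(volterraCLM hl hA ^ n) u t‖ ≤
      (∫ r in (0 : ℝ)..t, ‖A r‖) ^ n / n.factorial * ‖u‖ := by
  induction n generalizing t with
  | zero => simpa using u.norm_coe_le_norm t
  | succ n ih =>
    have hprim : IsPrimitiveOn (fun t => ∫ r in (0 : ℝ)..t, ‖A r‖) (‖A ·‖) 0 l :=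
      .of_eqOn_add_integral hA.norm fun t _ => (zero_add _).symm
    have hcont := hprim.continuousOn
    rw [uIcc_of_le hl] at hcont
    rw [pow_succ', mul_apply_eq_comp, volterraCLM_apply]
    refine (norm_integral_clm_apply_IccExtend_le hl hA _ t.2
      (((hcont.pow n).div_const _).mul_const _) ih).trans_eq ?_
    rw [← (hprim.mono (d := t) (uIcc_subset_uIcc_left ?_)).integral_pow_div_factorial_mul
      intervalIntegral.integral_same n, ← intervalIntegral.integral_mul_const]
    · simp only [Pi.pow_apply, mul_right_comm]
    · rw [uIcc_of_le hl]
      exact t.2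

lemma summable_volterraCLM_pow_apply [CompleteSpace X] (hl : 0 ≤ l)
    (hA : IntervalIntegrable A volume 0 l) (u : C(Icc 0 l, X)) :
    Summable fun n => (volterraCLM hl hA ^ n) u := by
  refine .of_norm_bounded
    ((Real.summable_pow_div_factorial (∫ r in (0 : ℝ)..l, ‖A r‖)).mul_right ‖u‖) fun n => ?_
  have hnonneg : ∀ t ∈ Icc 0 l, 0 ≤ ∫ r in (0 : ℝ)..t, ‖A r‖ := fun t ht =>
    intervalIntegral.integral_nonneg ht.1 fun _ _ => norm_nonneg _
  have hl' := hnonneg l ⟨hl, le_rfl⟩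
  refine (ContinuousMap.norm_le _ (by positivity)).2 fun t => ?_
  refine (norm_volterraCLM_pow_apply_le hl hA u n t).trans ?_
  gcongr
  exacts [hnonneg t t.2, integral_norm_le_integral_norm_of_mem_Icc hA t.2]

lemma sub_apply_tsum_pow_apply {R V : Type*} [Semiring R] [AddCommGroup V] [Module R V]
    [TopologicalSpace V] [IsTopologicalAddGroup V] [T2Space V] {K : V →L[R] V} {x : V}
    (h : Summable fun n => (K ^ n) x) : ∑' n, (K ^ n) x - K (∑' n, (K ^ n) x) = x := by
  rw [K.map_tsum h, h.tsum_eq_zero_add]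
  simp [pow_succ']

lemma exists_isPrimitiveOn_clm_apply [CompleteSpace X] (hl : 0 ≤ l)
    (hA : IntervalIntegrable A volume 0 l) (x : X) :
    ∃ u : ℝ → X, u 0 = x ∧ IsPrimitiveOn u (fun t => A t (u t)) 0 l := by
  obtain ⟨v, hv⟩ : ∃ v, v - volterraCLM hl hA v = .const _ x :=
    ⟨_, sub_apply_tsum_pow_apply (summable_volterraCLM_pow_apply hl hA (.const _ x))⟩
  have hint : ∀ t ∈ Icc 0 l,
      IccExtend hl v t = x + ∫ r in (0 : ℝ)..t, A r (IccExtend hl v r) := fun t ht => by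
    rw [IccExtend_of_mem hl _ ht, ← sub_eq_iff_eq_add, ← volterraCLM_apply hl hA v ⟨t, ht⟩]
    exact DFunLike.congr_fun hv ⟨t, ht⟩
  refine ⟨IccExtend hl v, by simpa using hint 0 ⟨le_rfl, hl⟩, ?_⟩
  refine .of_eqOn_add_integral (C := x)
    (intervalIntegrable_clm_apply_IccExtend hl hA v ⟨hl, le_rfl⟩) fun t ht => ?_
  exact hint t (uIcc_of_le hl ▸ ht)

end LinearODE

section SecondDerivative

lemma memLp_of_continuousOn_Icc {F : Type*} [NormedAddCommGroup F] {f : ℝ → F} {a b : ℝ}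
    (hf : ContinuousOn f (Icc a b)) (p : ℝ≥0∞) : MemLp f p (volume.restrict (Icc a b)) := by
  obtain ⟨C, hC⟩ := isCompact_Icc.exists_bound_of_continuousOn hf
  exact .of_bound (hf.aestronglyMeasurable measurableSet_Icc) C <|
    (ae_restrict_mem measurableSet_Icc).mono hC

variable {E F G : Type*} [NormedAddCommGroup E] [NormedSpace ℝ E] [NormedAddCommGroup F]
  [NormedSpace ℝ F] [NormedAddCommGroup G] [NormedSpace ℝ G] {l : ℝ}

/-- `f` is in `H²[0, l]`, with derivative `f'` and weak second derivative `f''`. In contrast to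
`MemH2` the derivatives are named, and only determined up to equality on `[0, l]`, respectively
almost everywhere there. -/
structure HasH2Derivs (l : ℝ) (f f' f'' : ℝ → F) : Prop where
  isPrimitiveOn : IsPrimitiveOn f f' 0 l
  isPrimitiveOn_deriv : IsPrimitiveOn f' f'' 0 l
  memLp : MemLp f'' 2 (volume.restrict (Icc 0 l))

namespace HasH2Derivs

section Basic

variable {f f' f'' g g' g'' : ℝ → F}

lemma continuousOn (hl : 0 ≤ l) (hf : HasH2Derivs l f f' f'') : ContinuousOn f (Icc 0 l) :=
  uIcc_of_le hl ▸ hf.isPrimitiveOn.continuousOn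

lemma continuousOn_deriv (hl : 0 ≤ l) (hf : HasH2Derivs l f f' f'') :
    ContinuousOn f' (Icc 0 l) :=
  uIcc_of_le hl ▸ hf.isPrimitiveOn_deriv.continuousOn

lemma congr_ae (hl : 0 ≤ l) (hf : HasH2Derivs l f f' f'')
    (h : f'' =ᵐ[volume.restrict (Icc 0 l)] g'') : HasH2Derivs l f f' g'' where
  isPrimitiveOn := hf.isPrimitiveOn
  isPrimitiveOn_deriv := hf.isPrimitiveOn_deriv.congr_ae <| by
    rwa [uIcc_of_le hl, ← ae_restrict_iff' measurableSet_Icc]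
  memLp := hf.memLp.ae_eq h

lemma sub (hf : HasH2Derivs l f f' f'') (hg : HasH2Derivs l g g' g'') :
    HasH2Derivs l (f - g) (f' - g') (f'' - g'') where
  isPrimitiveOn := hf.isPrimitiveOn.sub hg.isPrimitiveOn
  isPrimitiveOn_deriv := hf.isPrimitiveOn_deriv.sub hg.isPrimitiveOn_deriv
  memLp := hf.memLp.sub hg.memLp

lemma clm_apply (T : F →L[ℝ] G) (hf : HasH2Derivs l f f' f'') :
    HasH2Derivs l (fun t => T (f t)) (fun t => T (f' t)) (fun t => T (f'' t)) where
  isPrimitiveOn := hf.isPrimitiveOn.clm_apply T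
  isPrimitiveOn_deriv := hf.isPrimitiveOn_deriv.clm_apply T
  memLp := T.comp_memLp' hf.memLp

lemma of_hasDerivAt (hf : ∀ t, HasDerivAt f (f' t) t)
    (hf' : ∀ t, HasDerivAt f' (f'' t) t) (hf'' : Continuous f'') : HasH2Derivs l f f' f'' where
  isPrimitiveOn := .of_hasDerivWithinAt (fun t _ => (hf t).hasDerivWithinAt) fun t _ =>
    (hf' t).continuousAt.continuousWithinAt
  isPrimitiveOn_deriv :=
    .of_hasDerivWithinAt (fun t _ => (hf' t).hasDerivWithinAt) hf''.continuousOn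
  memLp := memLp_of_continuousOn_Icc hf''.continuousOn 2

end Basic

lemma bilin (hl : 0 ≤ l) (L : E →L[ℝ] F →L[ℝ] G) {B B' B'' : ℝ → E} {f f' f'' : ℝ → F}
    (hB : HasH2Derivs l B B' B'') (hf : HasH2Derivs l f f' f'') :
    HasH2Derivs l (fun t => L (B t) (f t)) (fun t => L (B t) (f' t) + L (B' t) (f t))
      (fun t => L (B t) (f'' t) + L (B' t) (f' t) + (L (B' t) (f' t) + L (B'' t) (f t))) where
  isPrimitiveOn := hB.isPrimitiveOn.bilin L hf.isPrimitiveOn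
  isPrimitiveOn_deriv := (hB.isPrimitiveOn.bilin L hf.isPrimitiveOn_deriv).add
    (hB.isPrimitiveOn_deriv.bilin L hf.isPrimitiveOn)
  memLp :=
    have hBf := memLp_of_continuousOn_Icc (hB.continuousOn hl) ∞
    have hB'f' := L.memLp_of_bilin 2 (memLp_of_continuousOn_Icc (hB.continuousOn_deriv hl) ∞)
      (memLp_of_continuousOn_Icc (hf.continuousOn_deriv hl) 2)
    ((L.memLp_of_bilin 2 hBf hf.memLp).add hB'f').add (hB'f'.add
      (L.memLp_of_bilin 2 hB.memLp (memLp_of_continuousOn_Icc (hf.continuousOn hl) ∞)))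

lemma isPrimitiveOn_wronskian (L : E →L[ℝ] F →L[ℝ] G) {B B' B'' : ℝ → E} {f f' f'' : ℝ → F}
    (hB : HasH2Derivs l B B' B'') (hf : HasH2Derivs l f f' f'') :
    IsPrimitiveOn (fun t => L (B t) (f' t) - L (B' t) (f t))
      (fun t => L (B t) (f'' t) - L (B'' t) (f t)) 0 l := by
  refine ((hB.isPrimitiveOn.bilin L hf.isPrimitiveOn_deriv).sub
    (hB.isPrimitiveOn_deriv.bilin L hf.isPrimitiveOn)).congr_ae (.of_forall fun t _ => ?_)
  simp only [Pi.sub_apply]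
  abel

section SegDeriv

variable [CompleteSpace F] {f f' f'' : ℝ → F}

lemma hasDerivWithinAt (hl : 0 ≤ l) (hf : HasH2Derivs l f f' f'') {t : ℝ} (ht : t ∈ Icc 0 l) :
    HasDerivWithinAt f (f' t) (Icc 0 l) t :=
  hf.isPrimitiveOn.hasDerivWithinAt hl (hf.continuousOn_deriv hl) ht

lemma segDeriv_eq (hl : 0 < l) (hf : HasH2Derivs l f f' f'') {t : ℝ} (ht : t ∈ Icc 0 l) :
    segDeriv l f t = f' t :=
  (hf.hasDerivWithinAt hl.le ht).derivWithin (uniqueDiffOn_Icc hl t ht)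

lemma memH2 (hl : 0 < l) (hf : HasH2Derivs l f f' f'') : MemH2 l f where
  differentiableOn _ ht := (hf.hasDerivWithinAt hl.le ht).differentiableWithinAt
  exists_second := ⟨f'', hf.memLp, fun t ht => by
    rw [hf.segDeriv_eq hl ht, hf.segDeriv_eq hl ⟨le_rfl, hl.le⟩]
    exact hf.isPrimitiveOn_deriv.eq_add_integral (uIcc_of_le hl.le ▸ ht)⟩

lemma segDeriv_segDeriv_ae_eq (hl : 0 < l) (hf : HasH2Derivs l f f' f'') :
    segDeriv l (segDeriv l f) =ᵐ[volume.restrict (Icc 0 l)] f'' := by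
  rw [Filter.EventuallyEq, ae_restrict_iff' measurableSet_Icc]
  filter_upwards [hf.isPrimitiveOn_deriv.ae_hasDerivAt] with t hderiv ht
  rw [segDeriv_congr (fun s hs => hf.segDeriv_eq hl hs) ht]
  exact (hderiv (uIcc_of_le hl.le ▸ ht)).hasDerivWithinAt.derivWithin (uniqueDiffOn_Icc hl t ht)

end SegDeriv

end HasH2Derivs

lemma MemH2.exists_hasH2Derivs [CompleteSpace F] (hl : 0 < l) {f : ℝ → F} (hf : MemH2 l f) :
    ∃ f'', HasH2Derivs l f (segDeriv l f) f'' := by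
  obtain ⟨f'', hf'', hprim⟩ := hf.exists_second
  have hderiv : IsPrimitiveOn (segDeriv l f) f'' 0 l :=
    .of_eqOn_add_integral (intervalIntegrable_of_memLp hf'' ⟨hl.le, le_rfl⟩) <| by
      rwa [uIcc_of_le hl.le]
  refine ⟨f'', .of_hasDerivWithinAt ?_ hderiv.continuousOn, hderiv, hf''⟩
  rw [uIcc_of_le hl.le]
  exact fun t ht => (hf.differentiableOn t ht).hasDerivWithinAt

lemma MemH2.hasH2Derivs [CompleteSpace F] (hl : 0 < l) {f : ℝ → F} (hf : MemH2 l f) :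
    HasH2Derivs l f (segDeriv l f) (segDeriv l (segDeriv l f)) := by
  obtain ⟨f'', h⟩ := hf.exists_hasH2Derivs hl
  exact h.congr_ae hl.le (h.segDeriv_segDeriv_ae_eq hl).symm

end SecondDerivative

section Hill

variable {F : Type*} [NormedAddCommGroup F] [NormedSpace ℂ F] {l : ℝ} {V : ℝ → ℂ}

/-- `f ∈ H²[0, l]` is a solution, with derivative `f'`, of the equation `f'' = V f`. -/
def IsHillSolution (l : ℝ) (V : ℝ → ℂ) (f f' : ℝ → F) : Prop :=
  HasH2Derivs l f f' fun t => V t • f t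

lemma exists_isHillSolution [CompleteSpace F] (hl : 0 ≤ l)
    (hV : MemLp V 2 (volume.restrict (Icc 0 l))) (p q : F) :
    ∃ y y' : ℝ → F, IsHillSolution l V y y' ∧ y 0 = p ∧ y' 0 = q := by
  let D : F × F →L[ℝ] F × F := (ContinuousLinearMap.snd ℝ F F).prod 0
  let M : F × F →L[ℝ] F × F := (0 : F × F →L[ℝ] F).prod (ContinuousLinearMap.fst ℝ F F)
  have hA : IntervalIntegrable (fun t => D + V t • M) volume 0 l :=
    intervalIntegrable_const.add
      ((intervalIntegrable_of_memLp hV ⟨hl, le_rfl⟩).smul_continuousOn continuousOn_const)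
  obtain ⟨u, hu0, hu⟩ := exists_isPrimitiveOn_clm_apply hl hA (p, q)
  have hfst : IsPrimitiveOn (fun t => (u t).1) (fun t => (u t).2) 0 l := by
    simpa [D, M] using hu.clm_apply (ContinuousLinearMap.fst ℝ F F)
  have hsnd : IsPrimitiveOn (fun t => (u t).2) (fun t => V t • (u t).1) 0 l := by
    simpa [D, M] using hu.clm_apply (ContinuousLinearMap.snd ℝ F F)
  have hcont : ContinuousOn (fun t => (u t).1) (Icc 0 l) := uIcc_of_le hl ▸ hfst.continuousOn
  refine ⟨_, _, ⟨hfst, hsnd, ?_⟩, by rw [hu0], by rw [hu0]⟩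
  exact (ContinuousLinearMap.lsmul ℝ ℂ).memLp_of_bilin 2 hV (memLp_of_continuousOn_Icc hcont ∞)

namespace IsHillSolution

lemma smul_sub_smul_eq (hl : 0 ≤ l) {y y' : ℝ → ℂ} {g g' : ℝ → F}
    (hy : IsHillSolution l V y y') (hg : IsHillSolution l V g g') {t : ℝ} (ht : t ∈ Icc 0 l) :
    y t • g' t - y' t • g t = y 0 • g' 0 - y' 0 • g 0 :=
  (hy.isPrimitiveOn_wronskian (ContinuousLinearMap.lsmul ℝ ℂ) hg).eq_of_ae_eq_zero
    (.of_forall fun t _ => by simp [smul_smul, mul_comm]) (uIcc_of_le hl ▸ ht)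

section FundamentalSystem

variable {s s' c c' : ℝ → ℂ} {g g' : ℝ → F}

lemma cos_mul_deriv_sin_sub (hl : 0 ≤ l) (hs : IsHillSolution l V s s')
    (hc : IsHillSolution l V c c') (hs0 : s 0 = 0) (hs'0 : s' 0 = 1) (hc0 : c 0 = 1)
    {t : ℝ} (ht : t ∈ Icc 0 l) : c t * s' t - c' t * s t = 1 := by
  simpa [hs0, hs'0, hc0] using hc.smul_sub_smul_eq hl hs ht

lemma eq_cos_smul_add_sin_smul (hl : 0 ≤ l) (hs : IsHillSolution l V s s')
    (hc : IsHillSolution l V c c') (hs0 : s 0 = 0) (hs'0 : s' 0 = 1) (hc0 : c 0 = 1)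
    (hc'0 : c' 0 = 0) (hg : IsHillSolution l V g g') {t : ℝ} (ht : t ∈ Icc 0 l) :
    g t = c t • g 0 + s t • g' 0 ∧ g' t = c' t • g 0 + s' t • g' 0 := by
  have hsg : s t • g' t - s' t • g t = -g 0 := by
    simpa [hs0, hs'0] using hs.smul_sub_smul_eq hl hg ht
  have hcg : c t • g' t - c' t • g t = g' 0 := by
    simpa [hc0, hc'0] using hc.smul_sub_smul_eq hl hg ht
  have hdet := hs.cos_mul_deriv_sin_sub hl hc hs0 hs'0 hc0 ht
  rw [← hcg, ← neg_eq_iff_eq_neg.2 hsg]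
  constructor
  · linear_combination (norm := module) (-hdet) • g t
  · linear_combination (norm := module) (-hdet) • g' t

lemma deriv_zero_eq (hl : 0 ≤ l) (hs : IsHillSolution l V s s')
    (hc : IsHillSolution l V c c') (hs0 : s 0 = 0) (hs'0 : s' 0 = 1) (hc0 : c 0 = 1)
    (hc'0 : c' 0 = 0) (hsl : s l ≠ 0) (hg : IsHillSolution l V g g') :
    g' 0 = (s l)⁻¹ • (g l - c l • g 0) := by
  rw [(eq_cos_smul_add_sin_smul hl hs hc hs0 hs'0 hc0 hc'0 hg ⟨hl, le_rfl⟩).1,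
    add_sub_cancel_left, inv_smul_smul₀ hsl]

end FundamentalSystem

end IsHillSolution

end Hill

section LpNorm

variable {Ω F G : Type*} [MeasurableSpace Ω] {μ : Measure Ω} [NormedAddCommGroup F]
  [NormedAddCommGroup G]

lemma lpNorm_le_mul_lpNorm_of_ae_le {p : ℝ≥0∞} {f : Ω → F} {g : Ω → G} {C : ℝ} (hC : 0 ≤ C)
    (hg : MemLp g p μ) (h : ∀ᵐ x ∂μ, ‖f x‖ ≤ C * ‖g x‖) :
    lpNorm f p μ ≤ C * lpNorm g p μ := by
  by_cases hf : AEStronglyMeasurable f μ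
  · rw [← toReal_eLpNorm hf, ← toReal_eLpNorm hg.1, ← ENNReal.toReal_ofReal hC,
      ← ENNReal.toReal_mul]
    exact ENNReal.toReal_mono (ENNReal.mul_ne_top ENNReal.ofReal_ne_top hg.eLpNorm_ne_top)
      (eLpNorm_le_mul_eLpNorm_of_ae_le_mul h p)
  · rw [lpNorm_of_not_aestronglyMeasurable hf]
    exact mul_nonneg hC lpNorm_nonneg

lemma lpNorm_one_smul_le_mul_lpNorm {𝕜 : Type*} [NormedField 𝕜] [NormedSpace 𝕜 F]
    {p q : ℝ≥0∞} [ENNReal.HolderTriple p q 1] {ψ : Ω → 𝕜} {g : Ω → F} (hψ : MemLp ψ p μ)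
    (hg : MemLp g q μ) : lpNorm (ψ • g) 1 μ ≤ lpNorm ψ p μ * lpNorm g q μ := by
  rw [← toReal_eLpNorm (hψ.1.smul hg.1), ← toReal_eLpNorm hψ.1, ← toReal_eLpNorm hg.1,
    ← ENNReal.toReal_mul]
  exact ENNReal.toReal_mono (ENNReal.mul_ne_top hψ.eLpNorm_ne_top hg.eLpNorm_ne_top)
    (eLpNorm_smul_le_mul_eLpNorm hg.1 hψ.1)

lemma lpNorm_two_one_restrict_Icc {l : ℝ} (hl : 0 ≤ l) :
    lpNorm (1 : ℝ → ℝ) 2 (volume.restrict (Icc 0 l)) = √l := by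
  rw [lpNorm_one' two_ne_zero ENNReal.ofNat_ne_top, Real.sqrt_eq_rpow]
  simp [hl]

end LpNorm

section BoundaryValues

variable {F : Type*} [NormedAddCommGroup F] [NormedSpace ℝ F] [CompleteSpace F] {l : ℝ}
  {f f' f'' : ℝ → F}

lemma HasH2Derivs.norm_wronskian_sub_le (hl : 0 ≤ l) {φ φ' φ'' : ℝ → ℝ} {C D : ℝ}
    (hφ : HasH2Derivs l φ φ' φ'') (hC : ∀ t ∈ Icc 0 l, |φ t| ≤ C)
    (hD : ∀ t ∈ Icc 0 l, |φ'' t| ≤ D) (hf : HasH2Derivs l f f' f'') :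
    ‖φ l • f' l - φ' l • f l - (φ 0 • f' 0 - φ' 0 • f 0)‖ ≤
      C * lpNorm f'' 1 (volume.restrict (Icc 0 l)) +
        D * lpNorm f 1 (volume.restrict (Icc 0 l)) := by
  have hf_mem := memLp_of_continuousOn_Icc (hf.continuousOn hl) 1
  have hf''_int : Integrable f'' (volume.restrict (Icc 0 l)) := hf.memLp.integrable one_le_two
  have hgreen := (hφ.isPrimitiveOn_wronskian (ContinuousLinearMap.lsmul ℝ ℝ) hf).eq_add_integral
    right_mem_uIcc
  simp only [ContinuousLinearMap.lsmul_apply] at hgreen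
  rw [hgreen, add_sub_cancel_left, intervalIntegral.integral_of_le hl,
    ← integral_Icc_eq_integral_Ioc, lpNorm_one_eq_integral_norm hf''_int.1,
    lpNorm_one_eq_integral_norm hf_mem.1, ← integral_const_mul, ← integral_const_mul,
    ← integral_add (hf''_int.norm.const_mul C) ((hf_mem.integrable le_rfl).norm.const_mul D)]
  refine norm_integral_le_of_norm_le
    ((hf''_int.norm.const_mul C).add ((hf_mem.integrable le_rfl).norm.const_mul D)) ?_
  filter_upwards [ae_restrict_mem measurableSet_Icc] with t ht
  refine (norm_sub_le _ _).trans ?_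
  rw [norm_smul, norm_smul]
  gcongr
  exacts [hC t ht, hD t ht]

section TestFunction

lemma hasDerivAt_mul_one_sub_div_sq (l t : ℝ) :
    HasDerivAt (fun t => t * (1 - t / l) ^ 2) ((1 - t / l) * (1 - 3 * (t / l))) t := by
  refine ((hasDerivAt_id t).mul
    ((((hasDerivAt_id t).div_const l).const_sub 1).pow 2)).congr_deriv ?_
  simp only [id, Pi.pow_apply]
  push_cast
  ring

lemma hasDerivAt_one_sub_div_mul (l t : ℝ) :
    HasDerivAt (fun t => (1 - t / l) * (1 - 3 * (t / l))) ((6 * (t / l) - 4) / l) t := by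
  have hdiv := (hasDerivAt_id t).div_const l
  refine ((hdiv.const_sub 1).mul ((hdiv.const_mul 3).const_sub 1)).congr_deriv ?_
  simp only [id]
  ring

lemma abs_mul_one_sub_div_sq_le {t : ℝ} (ht : t ∈ Icc 0 l) : |t * (1 - t / l) ^ 2| ≤ l := by
  have hl : 0 ≤ l := ht.1.trans ht.2
  have h0 : 0 ≤ t / l := div_nonneg ht.1 hl
  have h1 : t / l ≤ 1 := div_le_one_of_le₀ ht.2 hl
  rw [abs_of_nonneg (mul_nonneg ht.1 (sq_nonneg _))]
  exact (mul_le_of_le_one_right ht.1 (by nlinarith)).trans ht.2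

lemma abs_six_mul_div_sub_four_div_le {t : ℝ} (ht : t ∈ Icc 0 l) :
    |(6 * (t / l) - 4) / l| ≤ 4 / l := by
  have hl : 0 ≤ l := ht.1.trans ht.2
  have h0 : 0 ≤ t / l := div_nonneg ht.1 hl
  have h1 : t / l ≤ 1 := div_le_one_of_le₀ ht.2 hl
  rw [abs_div, abs_of_nonneg hl]
  gcongr
  exact abs_le.2 ⟨by linarith, by linarith⟩

end TestFunction

lemma HasH2Derivs.norm_apply_zero_le (hl : 0 < l) (hf : HasH2Derivs l f f' f'') :
    ‖f 0‖ ≤ l * lpNorm f'' 1 (volume.restrict (Icc 0 l)) +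
      4 / l * lpNorm f 1 (volume.restrict (Icc 0 l)) := by
  have hφ : HasH2Derivs l (fun t => t * (1 - t / l) ^ 2)
      (fun t => (1 - t / l) * (1 - 3 * (t / l))) (fun t => (6 * (t / l) - 4) / l) :=
    .of_hasDerivAt (hasDerivAt_mul_one_sub_div_sq l) (hasDerivAt_one_sub_div_mul l) (by fun_prop)
  simpa [hl.ne'] using hφ.norm_wronskian_sub_le hl.le (fun t => abs_mul_one_sub_div_sq_le)
    (fun t => abs_six_mul_div_sub_four_div_le) hf

lemma HasH2Derivs.norm_apply_right_le (hl : 0 < l) (hf : HasH2Derivs l f f' f'') :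
    ‖f l‖ ≤ l * lpNorm f'' 1 (volume.restrict (Icc 0 l)) +
      4 / l * lpNorm f 1 (volume.restrict (Icc 0 l)) := by
  have hmem : ∀ {t : ℝ}, t ∈ Icc 0 l → l - t ∈ Icc 0 l := fun ht =>
    ⟨sub_nonneg.2 ht.2, sub_le_self l ht.1⟩
  have hφ : HasH2Derivs l (fun t => (l - t) * (1 - (l - t) / l) ^ 2)
      (fun t => -((1 - (l - t) / l) * (1 - 3 * ((l - t) / l))))
      (fun t => (6 * ((l - t) / l) - 4) / l) :=
    .of_hasDerivAt (fun t => (hasDerivAt_mul_one_sub_div_sq l (l - t)).comp_const_sub l t)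
      (fun t => ((hasDerivAt_one_sub_div_mul l (l - t)).comp_const_sub l t).neg.congr_deriv
        (neg_neg _))
      (by fun_prop)
  simpa [hl.ne'] using hφ.norm_wronskian_sub_le hl.le
    (fun t ht => abs_mul_one_sub_div_sq_le (hmem ht))
    (fun t ht => abs_six_mul_div_sub_four_div_le (hmem ht)) hf

end BoundaryValues

namespace IsHillSolution

variable {F : Type*} [NormedAddCommGroup F] [NormedSpace ℂ F] [CompleteSpace F] {l : ℝ}
  {V : ℝ → ℂ} {g g' : ℝ → F}

lemma norm_apply_zero_add_norm_apply_right_le (hl : 0 < l)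
    (hV : MemLp V 2 (volume.restrict (Icc 0 l))) (hg : IsHillSolution l V g g') :
    ‖g 0‖ + ‖g l‖ ≤ 2 * (l * lpNorm V 2 (volume.restrict (Icc 0 l)) + 4 / l * √l) *
      lpNorm g 2 (volume.restrict (Icc 0 l)) := by
  have hg_mem := memLp_of_continuousOn_Icc (hg.continuousOn hl.le) 2
  have hone : MemLp (1 : ℝ → ℝ) 2 (volume.restrict (Icc 0 l)) :=
    memLp_of_continuousOn_Icc continuousOn_const 2
  have hVg : lpNorm (fun t => V t • g t) 1 (volume.restrict (Icc 0 l)) ≤ _ :=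
    lpNorm_one_smul_le_mul_lpNorm hV hg_mem
  have hg_one : lpNorm g 1 (volume.restrict (Icc 0 l)) ≤
      √l * lpNorm g 2 (volume.restrict (Icc 0 l)) := by
    simpa only [one_smul, lpNorm_two_one_restrict_Icc hl.le] using
      lpNorm_one_smul_le_mul_lpNorm hone hg_mem
  calc ‖g 0‖ + ‖g l‖
      ≤ 2 * (l * lpNorm (fun t => V t • g t) 1 (volume.restrict (Icc 0 l)) +
          4 / l * lpNorm g 1 (volume.restrict (Icc 0 l))) := by
        linarith [HasH2Derivs.norm_apply_zero_le hl hg, HasH2Derivs.norm_apply_right_le hl hg]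
    _ ≤ 2 * (l * (lpNorm V 2 (volume.restrict (Icc 0 l)) *
          lpNorm g 2 (volume.restrict (Icc 0 l))) +
          4 / l * (√l * lpNorm g 2 (volume.restrict (Icc 0 l)))) := by gcongr
    _ = _ := by ring

end IsHillSolution

section DirichletProblem

variable {F : Type*} [NormedAddCommGroup F] [NormedSpace ℂ F] {l C : ℝ} {V : ℝ → ℂ}

variable (F) in
/-- `C` bounds the `L²` norm of every solution `w ∈ H²([0, l], F)` of the Dirichlet problem
`w'' - V w = h`, `w 0 = w l = 0` by the `L²` norm of `h`. -/
def IsDirichletBound (l : ℝ) (V : ℝ → ℂ) (C : ℝ) : Prop :=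
  ∀ w w' w'' : ℝ → F, HasH2Derivs l w w' w'' → w 0 = 0 → w l = 0 →
    lpNorm w 2 (volume.restrict (Icc 0 l)) ≤
      C * lpNorm (fun t => w'' t - V t • w t) 2 (volume.restrict (Icc 0 l))

lemma norm_lineMap_div_le (p q : F) {t : ℝ} (ht : t ∈ Icc 0 l) :
    ‖AffineMap.lineMap (k := ℝ) p q (t / l)‖ ≤ ‖p‖ + ‖q‖ := by
  have hp : p ∈ Metric.closedBall (0 : F) (‖p‖ + ‖q‖) := by simp
  have hq : q ∈ Metric.closedBall (0 : F) (‖p‖ + ‖q‖) := by simp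
  simpa using (convex_closedBall (0 : F) _).lineMap_mem hp hq
    ⟨div_nonneg ht.1 (ht.1.trans ht.2), div_le_one_of_le₀ ht.2 (ht.1.trans ht.2)⟩

lemma hasH2Derivs_lineMap_div (l : ℝ) (p q : F) :
    HasH2Derivs l (fun t => AffineMap.lineMap (k := ℝ) p q (t / l)) (fun _ => l⁻¹ • (q - p)) 0 :=
  .of_hasDerivAt (fun t => by
    simpa [Function.comp_def] using
      (AffineMap.hasDerivAt_lineMap (a := p) (b := q) (x := t / l)).scomp t
        ((hasDerivAt_id t).div_const l)) (fun t => hasDerivAt_const t _) continuous_const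

-- Subtracting the affine interpolant of the boundary values leaves a Dirichlet problem.
lemma IsDirichletBound.lpNorm_le (hC : IsDirichletBound F l V C) (hC0 : 0 ≤ C) (hl : 0 < l)
    (hV : MemLp V 2 (volume.restrict (Icc 0 l))) {g g' : ℝ → F} (hg : IsHillSolution l V g g') :
    lpNorm g 2 (volume.restrict (Icc 0 l)) ≤
      (C * lpNorm V 2 (volume.restrict (Icc 0 l)) + √l) * (‖g 0‖ + ‖g l‖) := by
  set η : ℝ → F := fun t => AffineMap.lineMap (k := ℝ) (g 0) (g l) (t / l) with hη
  have hη_deriv : HasH2Derivs l η _ 0 := hasH2Derivs_lineMap_div l (g 0) (g l)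
  have hη_le : ∀ᵐ t ∂volume.restrict (Icc 0 l), ‖η t‖ ≤ ‖g 0‖ + ‖g l‖ :=
    (ae_restrict_mem measurableSet_Icc).mono fun t => norm_lineMap_div_le (g 0) (g l)
  have hdirichlet := hC _ _ _ (hg.sub hη_deriv) (by simp [hη]) (by simp [hη, hl.ne'])
  have hVη : lpNorm (fun t => V t • η t) 2 (volume.restrict (Icc 0 l)) ≤
      (‖g 0‖ + ‖g l‖) * lpNorm V 2 (volume.restrict (Icc 0 l)) := by
    refine lpNorm_le_mul_lpNorm_of_ae_le (by positivity) hV (hη_le.mono fun t ht => ?_)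
    rw [norm_smul, mul_comm]
    gcongr
  have hη_norm : lpNorm η 2 (volume.restrict (Icc 0 l)) ≤ (‖g 0‖ + ‖g l‖) * √l := by
    rw [← lpNorm_two_one_restrict_Icc hl.le]
    exact lpNorm_le_mul_lpNorm_of_ae_le (by positivity)
      (memLp_of_continuousOn_Icc continuousOn_const 2) (hη_le.mono fun t ht => by simpa using ht)
  calc lpNorm g 2 (volume.restrict (Icc 0 l))
      ≤ lpNorm η 2 (volume.restrict (Icc 0 l)) + lpNorm (g - η) 2 (volume.restrict (Icc 0 l)) :=
        lpNorm_le_lpNorm_add_lpNorm_sub'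
          (memLp_of_continuousOn_Icc (hη_deriv.continuousOn hl.le) 2) one_le_two
    _ ≤ (‖g 0‖ + ‖g l‖) * √l +
          C * ((‖g 0‖ + ‖g l‖) * lpNorm V 2 (volume.restrict (Icc 0 l))) := by
        refine add_le_add hη_norm (hdirichlet.trans ?_)
        simp only [Pi.sub_apply, Pi.zero_apply, sub_zero, smul_sub, sub_sub_cancel]
        gcongr
    _ = _ := by ring

lemma IsHillSolution.smul_const {y y' : ℝ → ℂ} (hy : IsHillSolution l V y y') (v : F) :
    IsHillSolution l V (fun t => y t • v) (fun t => y' t • v) := by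
  simpa [IsHillSolution, smul_smul] using
    hy.clm_apply ((ContinuousLinearMap.toSpanSingleton ℂ v).restrictScalars ℝ)

lemma IsDirichletBound.apply_right_ne_zero [Nontrivial F] (hC : IsDirichletBound F l V C)
    (hl : 0 < l) {s s' : ℝ → ℂ} (hs : IsHillSolution l V s s') (hs0 : s 0 = 0)
    (hs'0 : s' 0 ≠ 0) : s l ≠ 0 := by
  intro hsl
  obtain ⟨v, hv⟩ := exists_ne (0 : F)
  have hsv : IsHillSolution l V (fun t => s t • v) _ := hs.smul_const v
  have hsv_cont := hsv.continuousOn hl.le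
  have hnorm : lpNorm (fun t => s t • v) 2 (volume.restrict (Icc 0 l)) = 0 :=
    le_antisymm (by simpa using hC _ _ _ hsv (by simp [hs0]) (by simp [hsl])) lpNorm_nonneg
  have hzero : EqOn (fun t => s t • v) 0 (Icc 0 l) :=
    Measure.eqOn_Icc_of_ae_eq volume hl.ne
      ((lpNorm_eq_zero (memLp_of_continuousOn_Icc hsv_cont 2) two_ne_zero).1 hnorm)
      hsv_cont continuousOn_const
  have hs_zero : EqOn s 0 (Icc 0 l) := fun t ht => (smul_eq_zero.1 (hzero ht)).resolve_right hv
  refine hs'0 ?_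
  rw [← hs.segDeriv_eq hl ⟨le_rfl, hl.le⟩, segDeriv_congr hs_zero ⟨le_rfl, hl.le⟩, segDeriv,
    derivWithin_zero, Pi.zero_apply]

end DirichletProblem

section Exponential

variable {𝔸 : Type*} [NormedRing 𝔸] [NormedAlgebra ℂ 𝔸] [CompleteSpace 𝔸]

lemma exp_smul_one_add (c : ℂ) (Y : 𝔸) :
    NormedSpace.exp (c • (1 : 𝔸) + Y) = Complex.exp c • NormedSpace.exp Y := by
  let : NormedAlgebra ℚ 𝔸 := NormedAlgebra.restrictScalars ℚ ℂ 𝔸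
  rw [NormedSpace.exp_add_of_commute ((Commute.one_left Y).smul_left c),
    ← Algebra.algebraMap_eq_smul_one, ← NormedSpace.algebraMap_exp_comm, ← Complex.exp_eq_exp_ℂ,
    Algebra.smul_def]

lemma hasDerivAt_exp_smul_one_add_smul {φ : ℝ → ℂ} {φ' : ℂ} {t : ℝ} (hφ : HasDerivAt φ φ' t)
    (X : 𝔸) : HasDerivAt (fun t : ℝ => NormedSpace.exp (φ t • (1 : 𝔸) + t • X))
      ((φ' • (1 : 𝔸) + X) * NormedSpace.exp (φ t • (1 : 𝔸) + t • X)) t := by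
  simp only [exp_smul_one_add]
  refine (hφ.cexp.smul (hasDerivAt_exp_smul_const' (𝕂 := ℝ) X t)).congr_deriv ?_
  simp only [add_mul, mul_smul_comm, smul_mul_assoc, one_mul]
  module

end Exponential

section OperatorValued

variable {E F : Type*} [NormedAddCommGroup E] [NormedSpace ℂ E] [NormedAddCommGroup F]
  [NormedSpace ℂ F] {l : ℝ}

lemma hasH2Derivs_operator_apply (hl : 0 ≤ l) {B B' B'' : ℝ → E →L[ℂ] F} {f f' f'' : ℝ → E}
    (hB : HasH2Derivs l B B' B'') (hf : HasH2Derivs l f f' f'') :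
    HasH2Derivs l (fun t => B t (f t)) (fun t => B t (f' t) + B' t (f t))
      (fun t => B t (f'' t) + B' t (f' t) + (B' t (f' t) + B'' t (f t))) :=
  HasH2Derivs.bilin hl (ContinuousLinearMap.restrictScalarsL ℂ E F ℝ ℝ) hB hf

lemma hasDerivWithinAt_operator_apply {B : ℝ → E →L[ℂ] F} {B' : E →L[ℂ] F} {f : ℝ → E} {f' : E}
    {s : Set ℝ} {t : ℝ} (hB : HasDerivWithinAt B B' s t) (hf : HasDerivWithinAt f f' s t) :
    HasDerivWithinAt (fun t => B t (f t)) (B t f' + B' (f t)) s t :=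
  (ContinuousLinearMap.restrictScalarsL ℂ E F ℝ ℝ).hasDerivWithinAt_of_bilinear hB hf

end OperatorValued

namespace RashbaNetwork

variable (Q : RashbaNetwork) (e : Q.Edge)

lemma contDiff_a : ContDiff ℝ 1 (Q.a e) :=
  (Q.contDiff_A.comp (contDiff_const.add (contDiff_id.smul contDiff_const))).inner ℝ contDiff_const

lemma isSelfAdjoint_σ : IsSelfAdjoint (Q.σ e) := by
  rw [IsSelfAdjoint, σ, ← map_star]
  congr 1
  ext i j
  fin_cases i <;> fin_cases j <;> simp [Matrix.star_apply, sub_eq_add_neg]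

lemma hasDerivAt_gauge (t : ℝ) :
    HasDerivAt (Q.gauge e) (((deriv (Q.a e) t : ℝ) : ℂ) • (1 : Spinor →L[ℂ] Spinor)) t :=
  (((Q.contDiff_a e).differentiable one_ne_zero t).hasDerivAt.ofReal_comp.smul_const
    _).add_const _

lemma integral_gauge (t : ℝ) : ∫ r in (0 : ℝ)..t, Q.gauge e r =
    ((∫ r in (0 : ℝ)..t, Q.a e r : ℝ) : ℂ) • (1 : Spinor →L[ℂ] Spinor) +
      t • (Q.kR : ℂ) • Q.σ e := by
  have ha := (Q.contDiff_a e).continuous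
  have ha_int : IntervalIntegrable (fun r => (Q.a e r : ℂ) • (1 : Spinor →L[ℂ] Spinor))
      volume 0 t :=
    Continuous.intervalIntegrable (by fun_prop) _ _
  simp only [gauge]
  rw [intervalIntegral.integral_add ha_int intervalIntegrable_const,
    intervalIntegral.integral_smul_const, intervalIntegral.integral_const,
    intervalIntegral.integral_ofReal, sub_zero]

lemma Θ_eq_exp (t : ℝ) : Q.Θ e t = NormedSpace.exp
    ((Complex.I * (∫ r in (0 : ℝ)..t, Q.a e r : ℝ)) • (1 : Spinor →L[ℂ] Spinor) +
      t • Complex.I • (Q.kR : ℂ) • Q.σ e) := by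
  rw [Θ, integral_gauge, smul_add, smul_smul, smul_comm Complex.I t]

lemma Θ_zero : Q.Θ e 0 = 1 := by
  rw [Θ, intervalIntegral.integral_same]
  exact (congrArg NormedSpace.exp (smul_zero _)).trans NormedSpace.exp_zero

lemma hasDerivAt_Θ (t : ℝ) : HasDerivAt (Q.Θ e) (Complex.I • (Q.gauge e t * Q.Θ e t)) t := by
  have ha : HasDerivAt (fun t => ∫ r in (0 : ℝ)..t, Q.a e r) (Q.a e t) t :=
    ((Q.contDiff_a e).continuous.integral_hasStrictDerivAt 0 t).hasDerivAt
  have hexp := hasDerivAt_exp_smul_one_add_smul (ha.ofReal_comp.const_mul Complex.I)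
    (Complex.I • (Q.kR : ℂ) • Q.σ e)
  simp only [← Θ_eq_exp] at hexp
  refine hexp.congr_deriv ?_
  rw [gauge, ← smul_mul_assoc, smul_add, smul_smul Complex.I (Q.a e t : ℂ)]

lemma isSelfAdjoint_integral_gauge (t : ℝ) :
    IsSelfAdjoint (∫ r in (0 : ℝ)..t, Q.gauge e r) := by
  have hsmul {X : Spinor →L[ℂ] Spinor} (r : ℝ) (hX : IsSelfAdjoint X) :
      IsSelfAdjoint ((r : ℂ) • X) := .smul (A := Spinor →L[ℂ] Spinor) (Complex.conj_ofReal r) hX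
  rw [integral_gauge]
  exact IsSelfAdjoint.add (R := Spinor →L[ℂ] Spinor) (hsmul _ (.one _))
    (hsmul t (hsmul Q.kR (Q.isSelfAdjoint_σ e)))

lemma Θ_mem_unitary (t : ℝ) : Q.Θ e t ∈ unitary (Spinor →L[ℂ] Spinor) :=
  (selfAdjoint.expUnitary ⟨_, Q.isSelfAdjoint_integral_gauge e t⟩).2

lemma Θ_star_apply (t : ℝ) (v : Spinor) : Q.Θ e t (star (Q.Θ e t) v) = v :=
  DFunLike.congr_fun (Unitary.mul_star_self_of_mem (Q.Θ_mem_unitary e t)) v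

lemma star_Θ_apply (t : ℝ) (v : Spinor) : star (Q.Θ e t) (Q.Θ e t v) = v :=
  DFunLike.congr_fun (Unitary.star_mul_self_of_mem (Q.Θ_mem_unitary e t)) v

lemma norm_Θ_apply (t : ℝ) (v : Spinor) : ‖Q.Θ e t v‖ = ‖v‖ :=
  ContinuousLinearMap.norm_map_of_mem_unitary (Q.Θ_mem_unitary e t) v

lemma exists_hasH2Derivs_Θ :
    ∃ B, HasH2Derivs (Q.len e) (Q.Θ e) (fun t => Complex.I • (Q.gauge e t * Q.Θ e t)) B := by
  refine ⟨_, .of_hasDerivAt (Q.hasDerivAt_Θ e)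
    (fun t => ((Q.hasDerivAt_gauge e t).mul (Q.hasDerivAt_Θ e t)).const_smul Complex.I) ?_⟩
  have hgauge : Continuous (Q.gauge e) :=
    continuous_iff_continuousAt.2 fun t => (Q.hasDerivAt_gauge e t).continuousAt
  have hΘ : Continuous (Q.Θ e) :=
    continuous_iff_continuousAt.2 fun t => (Q.hasDerivAt_Θ e t).continuousAt
  have ha : Continuous (deriv (Q.a e)) := (Q.contDiff_a e).continuous_deriv le_rfl
  fun_prop

/-- The gauge transform `Θ* f` of a function `f` on an edge. It removes the gauge potential from the
differential expression of the network. -/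
noncomputable def gaugeTransform (f : ℝ → Spinor) (t : ℝ) : Spinor := star (Q.Θ e t) (f t)

variable {e}

lemma Θ_gaugeTransform (f : ℝ → Spinor) : (fun t => Q.Θ e t (Q.gaugeTransform e f t)) = f :=
  funext fun t => Q.Θ_star_apply e t (f t)

lemma norm_gaugeTransform (f : ℝ → Spinor) (t : ℝ) : ‖Q.gaugeTransform e f t‖ = ‖f t‖ := by
  rw [← Q.norm_Θ_apply e t, gaugeTransform, Q.Θ_star_apply]

lemma gaugeTransform_zero (f : ℝ → Spinor) : Q.gaugeTransform e f 0 = f 0 := by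
  rw [gaugeTransform, Θ_zero, star_one, one_apply_eq_self]

lemma memH2_Θ {g g' g'' : ℝ → Spinor} (hg : HasH2Derivs (Q.len e) g g' g'') :
    MemH2 (Q.len e) fun t => Q.Θ e t (g t) :=
  have ⟨_, hΘ⟩ := Q.exists_hasH2Derivs_Θ e
  (hasH2Derivs_operator_apply (Q.len_pos e).le hΘ hg).memH2 (Q.len_pos e)

lemma exists_hasH2Derivs_gaugeTransform {f : ℝ → Spinor} (hf : MemH2 (Q.len e) f) :
    ∃ g' g'', HasH2Derivs (Q.len e) (Q.gaugeTransform e f) g' g'' :=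
  have ⟨_, hΘ⟩ := Q.exists_hasH2Derivs_Θ e
  have ⟨_, hf⟩ := hf.exists_hasH2Derivs (Q.len_pos e)
  ⟨_, _, hasH2Derivs_operator_apply (Q.len_pos e).le
    (hΘ.clm_apply (starL' ℝ : (Spinor →L[ℂ] Spinor) ≃L[ℝ] _).toContinuousLinearMap) hf⟩

lemma covDeriv_Θ {g : ℝ → Spinor} {g' : Spinor} {t : ℝ} (ht : t ∈ Icc 0 (Q.len e))
    (hg : HasDerivWithinAt g g' (Icc 0 (Q.len e)) t) :
    Q.covDeriv e (fun t => Q.Θ e t (g t)) t = Q.Θ e t g' := by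
  have hderiv := hasDerivWithinAt_operator_apply (Q.hasDerivAt_Θ e t).hasDerivWithinAt hg
  rw [covDeriv, segDeriv, hderiv.derivWithin (uniqueDiffOn_Icc (Q.len_pos e) t ht)]
  exact add_sub_cancel_right _ _

lemma momentum_eq_I_smul_covDeriv (f : ℝ → Spinor) (t : ℝ) :
    Q.momentum e f t = Complex.I • Q.covDeriv e f t := by
  rw [momentum, covDeriv, smul_sub, smul_smul, Complex.I_mul_I, neg_one_smul, sub_neg_eq_add]

variable (e) in
/-- The coefficient of the equation `y'' = (U - z) y` on an edge. -/
noncomputable def potential (z : ℂ) (t : ℝ) : ℂ := Q.U e t - z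

lemma memLp_potential (z : ℂ) : MemLp (Q.potential e z) 2 (Q.edgeMeasure e) :=
  (Q.memLp_U e).ofReal.sub (memLp_of_continuousOn_Icc continuousOn_const 2)

lemma edgeOp_Θ {g g' g'' : ℝ → Spinor} (hg : HasH2Derivs (Q.len e) g g' g'') (E : ℂ) :
    Q.edgeOp e (fun t => Q.Θ e t (g t)) =ᵐ[Q.edgeMeasure e] fun t =>
      E • Q.Θ e t (g t) + Q.Θ e t (Q.potential e (E + (Q.kR : ℂ) ^ 2) t • g t - g'' t) := by
  have hmomentum : EqOn (Q.momentum e fun t => Q.Θ e t (g t))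
      (fun t => Q.Θ e t (Complex.I • g' t)) (Icc 0 (Q.len e)) := fun t ht => by
    simp only [momentum_eq_I_smul_covDeriv, map_smul,
      Q.covDeriv_Θ ht (hg.hasDerivWithinAt (Q.len_pos e).le ht)]
  rw [Filter.EventuallyEq, edgeMeasure, ae_restrict_iff' measurableSet_Icc]
  filter_upwards [hg.isPrimitiveOn_deriv.ae_hasDerivAt] with t hderiv ht
  have hg' := (hderiv (uIcc_of_le (Q.len_pos e).le ▸ ht)).hasDerivWithinAt (s := Icc 0 (Q.len e))
  rw [edgeOp, Q.momentum_congr e hmomentum ht, momentum_eq_I_smul_covDeriv,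
    Q.covDeriv_Θ ht (hg'.fun_const_smul Complex.I), map_smul, smul_smul, Complex.I_mul_I, map_sub,
    map_smul, potential]
  push_cast
  module

namespace IsContinuousSolution

variable {Q} {E : ℂ} {f : Q.Edge → ℝ → Spinor} {ξ : Q.Vertex → Spinor}

lemma exists_isHillSolution_gaugeTransform (hf : Q.IsContinuousSolution E f ξ) (e : Q.Edge) :
    ∃ g', IsHillSolution (Q.len e) (Q.potential e (E + (Q.kR : ℂ) ^ 2))
      (Q.gaugeTransform e (f e)) g' := by
  obtain ⟨g', g'', hg⟩ := Q.exists_hasH2Derivs_gaugeTransform (hf.memH2 e)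
  refine ⟨g', hg.congr_ae (Q.len_pos e).le ?_⟩
  filter_upwards [Q.edgeOp_Θ hg E, hf.equation e] with t hΘ hE
  rw [Θ_gaugeTransform, hE, congrFun (Q.Θ_gaugeTransform (f e)) t, left_eq_add] at hΘ
  have hzero := congrArg (star (Q.Θ e t) ·) hΘ
  simp only [star_Θ_apply, map_zero, sub_eq_zero] at hzero
  exact hzero.symm

end IsContinuousSolution

end RashbaNetwork

namespace RashbaNetwork

section ScalarSolutions

variable (Q : RashbaNetwork) (e : Q.Edge) (z : ℂ)

variable {Q e z} in
lemma isScalarSolution_iff {y : ℝ → ℂ} : Q.IsScalarSolution e z y ↔ MemH2 (Q.len e) y ∧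
    segDeriv (Q.len e) (segDeriv (Q.len e) y) =ᵐ[Q.edgeMeasure e]
      fun t => Q.potential e z t • y t :=
  and_congr_right fun _ => Filter.eventually_congr (.of_forall fun t => by
    simp only [potential, smul_eq_mul]
    constructor <;> intro h <;> linear_combination -h)

variable {Q e z} in
lemma IsScalarSolution.isHillSolution {y : ℝ → ℂ} (hy : Q.IsScalarSolution e z y) :
    IsHillSolution (Q.len e) (Q.potential e z) y (segDeriv (Q.len e) y) := by
  obtain ⟨hmem, hequation⟩ := isScalarSolution_iff.1 hy
  exact (hmem.hasH2Derivs (Q.len_pos e)).congr_ae (Q.len_pos e).le hequation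

lemma exists_isScalarSolution (p q : ℂ) :
    ∃ y, Q.IsScalarSolution e z y ∧ y 0 = p ∧ segDeriv (Q.len e) y 0 = q := by
  have hlen := Q.len_pos e
  obtain ⟨y, y', hy, hy0, hy'0⟩ := exists_isHillSolution hlen.le (Q.memLp_potential z) p q
  refine ⟨y, isScalarSolution_iff.2 ⟨HasH2Derivs.memH2 hlen hy,
    HasH2Derivs.segDeriv_segDeriv_ae_eq hlen hy⟩, hy0, ?_⟩
  rw [HasH2Derivs.segDeriv_eq hlen hy (Q.left_mem e), hy'0]

lemma isSineSolution_s : Q.IsSineSolution e z (Q.s e z) :=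
  Classical.epsilon_spec (Q.exists_isScalarSolution e z 0 1)

lemma isCosineSolution_c : Q.IsCosineSolution e z (Q.c e z) :=
  Classical.epsilon_spec (Q.exists_isScalarSolution e z 1 0)

lemma isHillSolution_s : IsHillSolution (Q.len e) (Q.potential e z) (Q.s e z) (Q.s' e z) :=
  (Q.isSineSolution_s e z).1.isHillSolution

lemma isHillSolution_c : IsHillSolution (Q.len e) (Q.potential e z) (Q.c e z)
    (segDeriv (Q.len e) (Q.c e z)) :=
  (Q.isCosineSolution_c e z).1.isHillSolution

end ScalarSolutions

end RashbaNetwork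

section PartialOperators

lemma mem_graph_domRestrict_iff {R E F : Type*} [Ring R] [AddCommGroup E] [Module R E]
    [AddCommGroup F] [Module R F] {T : E →ₗ.[R] F} {S : Submodule R E} {x : E × F} :
    x ∈ (T.domRestrict S).graph ↔ x ∈ T.graph ∧ x.1 ∈ S := by
  simp only [LinearPMap.mem_graph_iff]
  constructor
  · rintro ⟨y, hy, hTy⟩
    exact ⟨⟨⟨y, y.2.2⟩, hy, hTy ▸ (LinearPMap.domRestrict_apply rfl).symm⟩, hy ▸ y.2.1⟩
  · rintro ⟨⟨y, hy, hTy⟩, hS⟩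
    exact ⟨⟨y, hy ▸ hS, y.2⟩, hy, hTy ▸ LinearPMap.domRestrict_apply rfl⟩

lemma exists_norm_le_of_notMem_unboundedSpectrum {H : Type*} [NormedAddCommGroup H]
    [NormedSpace ℂ H] {T : H →ₗ.[ℂ] H} {z : ℂ} (hz : z ∉ T.unboundedSpectrum) :
    ∃ C : ℝ, 0 ≤ C ∧ ∀ u v : H, (u, v) ∈ T.graph → ‖u‖ ≤ C * ‖v - z • u‖ := by
  obtain ⟨R, hR, -⟩ := not_not.1 hz
  refine ⟨‖R‖, norm_nonneg R, fun u v huv => ?_⟩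
  obtain ⟨x, rfl, rfl⟩ := (LinearPMap.mem_graph_iff T).1 huv
  simpa [hR x] using R.le_opNorm (T x - z • (x : H))

end PartialOperators

namespace RashbaNetwork

variable (Q : RashbaNetwork)

section DirichletOperator

variable {Q} {e : Q.Edge} {E : ℂ}

lemma mem_graph_dirichletOp_iff {u v : Q.StateSpace} :
    (u, v) ∈ Q.dirichletOp.graph ↔ (u, v) ∈ Q.maximalGraph ∧ u ∈ Q.dirichletDomain := by
  rw [dirichletOp, mem_graph_domRestrict_iff, graph_maximalOp]

open Classical in
lemma represents_single {f : ℝ → Spinor} (hf : MemLp f 2 (Q.edgeMeasure e)) :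
    Q.Represents (Pi.single e f) (lp.single 2 e (hf.toLp f)) := by
  intro e'
  obtain rfl | he := eq_or_ne e' e
  · rw [lp.single_apply_self, Pi.single_eq_same]
    exact hf.coeFn_toLp
  · rw [lp.single_apply_ne _ _ _ he, Pi.single_eq_of_ne he]
    exact Lp.coeFn_zero _ _ _

open Classical in
lemma single_mem_graph_dirichletOp {f g : ℝ → Spinor} (hf : MemH2 (Q.len e) f) (hf0 : f 0 = 0)
    (hfl : f (Q.len e) = 0) (hf_mem : MemLp f 2 (Q.edgeMeasure e))
    (hg : MemLp g 2 (Q.edgeMeasure e)) (hfg : Q.edgeOp e f =ᵐ[Q.edgeMeasure e] g) :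
    (lp.single 2 e (hf_mem.toLp f), lp.single 2 e (hg.toLp g)) ∈ Q.dirichletOp.graph := by
  have hH2 : ∀ e', MemH2 (Q.len e') (Pi.single (M := fun _ => ℝ → Spinor) e f e') := by
    intro e'
    obtain rfl | he := eq_or_ne e' e
    · rwa [Pi.single_eq_same]
    · rw [Pi.single_eq_of_ne he]
      exact MemH2.zero
  refine mem_graph_dirichletOp_iff.2
    ⟨⟨Pi.single e f, hH2, represents_single hf_mem, fun e' => ?_⟩,
      ⟨Pi.single e f, hH2, represents_single hf_mem, fun e' => ?_⟩⟩
  · refine (represents_single hg e').trans ?_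
    obtain rfl | he := eq_or_ne e' e
    · simpa only [Pi.single_eq_same] using hfg.symm
    · simpa only [Pi.single_eq_of_ne he] using (Q.edgeOp_zero e').symm
  · obtain rfl | he := eq_or_ne e' e
    · rw [Pi.single_eq_same]
      exact ⟨hf0, hfl⟩
    · rw [Pi.single_eq_of_ne he]
      exact ⟨rfl, rfl⟩

lemma exists_lpNorm_le_of_edgeOp_ae_eq (hE : E ∉ Q.dirichletOp.unboundedSpectrum) :
    ∃ C : ℝ, 0 ≤ C ∧ ∀ (e : Q.Edge) (f h : ℝ → Spinor), MemH2 (Q.len e) f → f 0 = 0 →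
      f (Q.len e) = 0 → MemLp h 2 (Q.edgeMeasure e) →
      Q.edgeOp e f =ᵐ[Q.edgeMeasure e] E • f + h →
      lpNorm f 2 (Q.edgeMeasure e) ≤ C * lpNorm h 2 (Q.edgeMeasure e) := by
  classical
  obtain ⟨C, hC0, hC⟩ := exists_norm_le_of_notMem_unboundedSpectrum hE
  refine ⟨C, hC0, fun e f h hf hf0 hfl hh hfh => ?_⟩
  have hf_mem : MemLp f 2 (Q.edgeMeasure e) :=
    memLp_of_continuousOn_Icc hf.differentiableOn.continuousOn 2
  have hEf := hf_mem.const_smul E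
  have hle := hC _ _ (single_mem_graph_dirichletOp hf hf0 hfl hf_mem (hEf.add hh) hfh)
  rwa [MemLp.toLp_add hEf hh, MemLp.toLp_const_smul E hf_mem, ← lp.single_smul, ← lp.single_sub,
    add_sub_cancel_left, lp.norm_single two_pos, lp.norm_single two_pos, Lp.norm_toLp,
    Lp.norm_toLp, toReal_eLpNorm hf_mem.1, toReal_eLpNorm hh.1] at hle

lemma memLp_Θ {g : ℝ → Spinor} (hg : MemLp g 2 (Q.edgeMeasure e)) :
    MemLp (fun t => Q.Θ e t (g t)) 2 (Q.edgeMeasure e) :=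
  (ContinuousLinearMap.id ℂ (Spinor →L[ℂ] Spinor)).memLp_of_bilin 2
    (memLp_of_continuousOn_Icc
      (fun t _ => (Q.hasDerivAt_Θ e t).continuousAt.continuousWithinAt) ∞) hg

lemma lpNorm_Θ {g : ℝ → Spinor} (hg : MemLp g 2 (Q.edgeMeasure e)) :
    lpNorm (fun t => Q.Θ e t (g t)) 2 (Q.edgeMeasure e) = lpNorm g 2 (Q.edgeMeasure e) := by
  rw [← lpNorm_norm (memLp_Θ hg).1, ← lpNorm_norm hg.1]
  simp only [norm_Θ_apply]

lemma exists_isDirichletBound (hE : E ∉ Q.dirichletOp.unboundedSpectrum) :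
    ∃ C : ℝ, 0 ≤ C ∧ ∀ e : Q.Edge,
      IsDirichletBound Spinor (Q.len e) (Q.potential e (E + (Q.kR : ℂ) ^ 2)) C := by
  obtain ⟨C, hC0, hC⟩ := exists_lpNorm_le_of_edgeOp_ae_eq hE
  refine ⟨C, hC0, fun e w w' w'' hw hw0 hwl => ?_⟩
  set V := Q.potential e (E + (Q.kR : ℂ) ^ 2)
  have hw_mem : ∀ p, MemLp w p (Q.edgeMeasure e) :=
    memLp_of_continuousOn_Icc (hw.continuousOn (Q.len_pos e).le)
  have hVw : MemLp (fun t => V t • w t - w'' t) 2 (Q.edgeMeasure e) :=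
    ((ContinuousLinearMap.lsmul ℝ ℂ).memLp_of_bilin 2 (Q.memLp_potential _) (hw_mem ∞)).sub
      hw.memLp
  have hbound := hC e _ _ (Q.memH2_Θ hw) (by simp [hw0]) (by simp [hwl]) (memLp_Θ hVw)
    (Q.edgeOp_Θ hw E)
  rw [lpNorm_Θ (hw_mem 2), lpNorm_Θ hVw] at hbound
  exact hbound.trans_eq (congrArg (C * ·) (lpNorm_sub_comm _ _ _ _))

lemma s_len_ne_zero (hE : E ∉ Q.dirichletOp.unboundedSpectrum) (e : Q.Edge) :
    Q.s e (E + (Q.kR : ℂ) ^ 2) (Q.len e) ≠ 0 := by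
  obtain ⟨C, -, hC⟩ := exists_isDirichletBound hE
  obtain ⟨-, hs0, hs'0⟩ := Q.isSineSolution_s e (E + (Q.kR : ℂ) ^ 2)
  exact (hC e).apply_right_ne_zero (Q.len_pos e) (Q.isHillSolution_s e _) hs0
    (hs'0.trans_ne one_ne_zero)

end DirichletOperator

section UniformBounds

lemma exists_lpNorm_potential_le (z : ℂ) :
    ∃ K : ℝ, ∀ e, lpNorm (Q.potential e z) 2 (Q.edgeMeasure e) ≤ K := by
  obtain ⟨a, b, -, hlen⟩ := Q.length_bounds
  obtain ⟨C, hC⟩ := Q.bounded_U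
  refine ⟨max C 0 + ‖z‖ * √b, fun e => ?_⟩
  have hU_real : MemLp (Q.U e) 2 (Q.edgeMeasure e) := Q.memLp_U e
  have hU : MemLp (fun t => (Q.U e t : ℂ)) 2 (Q.edgeMeasure e) := hU_real.ofReal
  have hU_le : lpNorm (fun t => (Q.U e t : ℂ)) 2 (Q.edgeMeasure e) ≤ max C 0 := by
    rw [← lpNorm_norm hU.1]
    simp only [Complex.norm_real]
    rw [lpNorm_norm hU_real.1, ← toReal_eLpNorm hU_real.1, ← ENNReal.toReal_ofReal']
    exact ENNReal.toReal_mono ENNReal.ofReal_ne_top (hC e)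
  have hz_le : lpNorm (fun _ => z) 2 (Q.edgeMeasure e) ≤ ‖z‖ * √b :=
    calc lpNorm (fun _ => z) 2 (Q.edgeMeasure e)
        ≤ ‖z‖ * lpNorm (1 : ℝ → ℝ) 2 (Q.edgeMeasure e) :=
          lpNorm_le_mul_lpNorm_of_ae_le (norm_nonneg z)
            (memLp_of_continuousOn_Icc continuousOn_const 2) (.of_forall fun _ => by simp)
      _ ≤ ‖z‖ * √b := by
          rw [edgeMeasure, lpNorm_two_one_restrict_Icc (Q.len_pos e).le]
          gcongr
          exact (hlen e.1 e.2).2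
  exact (lpNorm_sub_le hU one_le_two).trans (add_le_add hU_le hz_le)

lemma exists_norm_boundary_le (z : ℂ) : ∃ C : ℝ, ∀ (e : Q.Edge) (g g' : ℝ → Spinor),
    IsHillSolution (Q.len e) (Q.potential e z) g g' →
      ‖g 0‖ + ‖g (Q.len e)‖ ≤ C * lpNorm g 2 (Q.edgeMeasure e) := by
  obtain ⟨a, b, ha, hlen⟩ := Q.length_bounds
  obtain ⟨K, hK⟩ := Q.exists_lpNorm_potential_le z
  refine ⟨2 * (b * K + 4 / a * √b), fun e g g' hg => ?_⟩
  obtain ⟨hae, hbe⟩ : a ≤ Q.len e ∧ Q.len e ≤ b := hlen e.1 e.2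
  have hK0 : 0 ≤ K := lpNorm_nonneg.trans (hK e)
  have hb0 : 0 ≤ b := (Q.len_pos e).le.trans hbe
  refine (hg.norm_apply_zero_add_norm_apply_right_le (Q.len_pos e) (Q.memLp_potential z)).trans ?_
  gcongr
  exacts [lpNorm_nonneg, lpNorm_nonneg, hK e, le_rfl]

lemma exists_lpNorm_le_norm_boundary {E : ℂ} (hE : E ∉ Q.dirichletOp.unboundedSpectrum) :
    ∃ C : ℝ, ∀ (e : Q.Edge) (g g' : ℝ → Spinor),
      IsHillSolution (Q.len e) (Q.potential e (E + (Q.kR : ℂ) ^ 2)) g g' →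
        lpNorm g 2 (Q.edgeMeasure e) ≤ C * (‖g 0‖ + ‖g (Q.len e)‖) := by
  obtain ⟨a, b, -, hlen⟩ := Q.length_bounds
  obtain ⟨K, hK⟩ := Q.exists_lpNorm_potential_le (E + (Q.kR : ℂ) ^ 2)
  obtain ⟨C, hC0, hC⟩ := exists_isDirichletBound hE
  refine ⟨C * K + √b, fun e g g' hg => ?_⟩
  refine ((hC e).lpNorm_le hC0 (Q.len_pos e) (Q.memLp_potential _) hg).trans ?_
  gcongr
  exacts [hK e, (hlen e.1 e.2).2]

end UniformBounds

end RashbaNetwork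

namespace RashbaNetwork.IsContinuousSolution

variable {Q : RashbaNetwork} {E z : ℂ} {f : Q.Edge → ℝ → Spinor} {ξ : Q.Vertex → Spinor}
  {e : Q.Edge} {α : Q.Vertex}

lemma gaugeTransform_len (hf : Q.IsContinuousSolution E f ξ) :
    Q.gaugeTransform e (f e) (Q.len e) = star (Q.τ e) (ξ (Q.tgt e)) := by
  rw [gaugeTransform, (hf.vertexValues e).2, τ]

lemma exists_gaugeTransform_eq (hf : Q.IsContinuousSolution E f ξ)
    (hz : z = E + (Q.kR : ℂ) ^ 2) (hs : Q.s e z (Q.len e) ≠ 0) :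
    ∃ g', IsHillSolution (Q.len e) (Q.potential e z) (Q.gaugeTransform e (f e)) g' ∧
      g' 0 = (Q.s e z (Q.len e))⁻¹ •
        (star (Q.τ e) (ξ (Q.tgt e)) - Q.c e z (Q.len e) • ξ (Q.src e)) ∧
      ∀ t ∈ Icc 0 (Q.len e),
        Q.gaugeTransform e (f e) t = Q.c e z t • ξ (Q.src e) + Q.s e z t • g' 0 ∧
        g' t = segDeriv (Q.len e) (Q.c e z) t • ξ (Q.src e) + Q.s' e z t • g' 0 := by
  obtain ⟨g', hg⟩ := hf.exists_isHillSolution_gaugeTransform e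
  rw [← hz] at hg
  obtain ⟨-, hs0, hs'0⟩ := Q.isSineSolution_s e z
  obtain ⟨-, hc0, hc'0⟩ := Q.isCosineSolution_c e z
  have hlen := (Q.len_pos e).le
  have hsin := Q.isHillSolution_s e z
  have hcos := Q.isHillSolution_c e z
  have hsrc : Q.gaugeTransform e (f e) 0 = ξ (Q.src e) := by
    rw [gaugeTransform_zero, (hf.vertexValues e).1]
  refine ⟨g', hg, ?_, fun t ht => ?_⟩
  · rw [← hsrc, ← hf.gaugeTransform_len]
    exact IsHillSolution.deriv_zero_eq hlen hsin hcos hs0 hs'0 hc0 hc'0 hs hg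
  · rw [← hsrc]
    exact IsHillSolution.eq_cos_smul_add_sin_smul hlen hsin hcos hs0 hs'0 hc0 hc'0 hg ht

theorem apply_eq (hf : Q.IsContinuousSolution E f ξ) (hz : z = E + (Q.kR : ℂ) ^ 2)
    (hs : Q.s e z (Q.len e) ≠ 0) {t : ℝ} (ht : t ∈ Icc 0 (Q.len e)) :
    f e t = (Q.s e z t / Q.s e z (Q.len e)) •
        Q.Θ e t (star (Q.τ e) (ξ (Q.tgt e)) - Q.c e z (Q.len e) • ξ (Q.src e)) +
      Q.Θ e t (Q.c e z t • ξ (Q.src e)) := by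
  obtain ⟨g', -, hg'0, hg⟩ := hf.exists_gaugeTransform_eq hz hs
  rw [← congrFun (Q.Θ_gaugeTransform (f e)) t, (hg t ht).1, hg'0, smul_smul, map_add, add_comm,
    map_smul, div_eq_mul_inv]

lemma covDeriv_eq (hf : Q.IsContinuousSolution E f ξ) (hz : z = E + (Q.kR : ℂ) ^ 2)
    (hs : Q.s e z (Q.len e) ≠ 0) {t : ℝ} (ht : t ∈ Icc 0 (Q.len e)) :
    Q.covDeriv e (f e) t = Q.Θ e t (segDeriv (Q.len e) (Q.c e z) t • ξ (Q.src e) +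
      (Q.s' e z t / Q.s e z (Q.len e)) •
        (star (Q.τ e) (ξ (Q.tgt e)) - Q.c e z (Q.len e) • ξ (Q.src e))) := by
  obtain ⟨g', hg_sol, hg'0, hg⟩ := hf.exists_gaugeTransform_eq hz hs
  rw [← Q.Θ_gaugeTransform (f e), Q.covDeriv_Θ ht (hg_sol.hasDerivWithinAt (Q.len_pos e).le ht),
    (hg t ht).2, hg'0, smul_smul, div_eq_mul_inv]

lemma covDeriv_zero (hf : Q.IsContinuousSolution E f ξ) (hz : z = E + (Q.kR : ℂ) ^ 2)
    (hs : Q.s e z (Q.len e) ≠ 0) :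
    Q.covDeriv e (f e) 0 = (1 / Q.s e z (Q.len e)) • star (Q.τ e) (ξ (Q.tgt e)) -
      (Q.c e z (Q.len e) / Q.s e z (Q.len e)) • ξ (Q.src e) := by
  rw [hf.covDeriv_eq hz hs (Q.left_mem e), Θ_zero, one_apply_eq_self,
    (Q.isCosineSolution_c e z).2.2, show Q.s' e z 0 = 1 from (Q.isSineSolution_s e z).2.2]
  module

lemma covDeriv_len (hf : Q.IsContinuousSolution E f ξ) (hz : z = E + (Q.kR : ℂ) ^ 2)
    (hs : Q.s e z (Q.len e) ≠ 0) :
    Q.covDeriv e (f e) (Q.len e) = (Q.s' e z (Q.len e) / Q.s e z (Q.len e)) • ξ (Q.tgt e) -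
      (1 / Q.s e z (Q.len e)) • Q.τ e (ξ (Q.src e)) := by
  obtain ⟨-, hs0, hs'0⟩ := Q.isSineSolution_s e z
  have hwronskian : Q.c e z (Q.len e) * Q.s' e z (Q.len e) -
      segDeriv (Q.len e) (Q.c e z) (Q.len e) * Q.s e z (Q.len e) = 1 :=
    IsHillSolution.cos_mul_deriv_sin_sub (Q.len_pos e).le (Q.isHillSolution_s e z)
      (Q.isHillSolution_c e z) hs0 hs'0 (Q.isCosineSolution_c e z).2.1 (Q.right_mem e)
  have hc' : segDeriv (Q.len e) (Q.c e z) (Q.len e) =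
      (Q.c e z (Q.len e) * Q.s' e z (Q.len e) - 1) / Q.s e z (Q.len e) :=
    eq_div_of_mul_eq hs (by rw [← hwronskian]; ring)
  have hτ : Q.τ e (star (Q.τ e) (ξ (Q.tgt e))) = ξ (Q.tgt e) := Q.Θ_star_apply e _ _
  rw [hf.covDeriv_eq hz hs (Q.right_mem e), ← τ, hc']
  simp only [map_add, map_smul, map_sub, hτ]
  module

lemma finsum_covDeriv_outEdges (hf : Q.IsContinuousSolution E f ξ)
    (hz : z = E + (Q.kR : ℂ) ^ 2) (hs : ∀ e, Q.s e z (Q.len e) ≠ 0) :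
    ∑ᶠ e ∈ Q.outEdges α, Q.covDeriv e (f e) 0 =
      (∑ᶠ e ∈ Q.outEdges α, (1 / Q.s e z (Q.len e)) • star (Q.τ e) (ξ (Q.tgt e))) -
        (∑ᶠ e ∈ Q.outEdges α, Q.c e z (Q.len e) / Q.s e z (Q.len e)) • ξ α := by
  have hfin := Q.finite_outEdges α
  simp only [finsum_mem_eq_finite_toFinset_sum _ hfin, Finset.sum_smul, ← Finset.sum_sub_distrib]
  refine Finset.sum_congr rfl fun e he => ?_
  rw [hf.covDeriv_zero hz (hs e), show Q.src e = α from hfin.mem_toFinset.1 he]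

lemma finsum_covDeriv_inEdges (hf : Q.IsContinuousSolution E f ξ)
    (hz : z = E + (Q.kR : ℂ) ^ 2) (hs : ∀ e, Q.s e z (Q.len e) ≠ 0) :
    ∑ᶠ e ∈ Q.inEdges α, Q.covDeriv e (f e) (Q.len e) =
      (∑ᶠ e ∈ Q.inEdges α, Q.s' e z (Q.len e) / Q.s e z (Q.len e)) • ξ α -
        ∑ᶠ e ∈ Q.inEdges α, (1 / Q.s e z (Q.len e)) • Q.τ e (ξ (Q.src e)) := by
  have hfin := Q.finite_inEdges α
  simp only [finsum_mem_eq_finite_toFinset_sum _ hfin, Finset.sum_smul, ← Finset.sum_sub_distrib]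
  refine Finset.sum_congr rfl fun e he => ?_
  rw [hf.covDeriv_len hz (hs e), show Q.tgt e = α from hfin.mem_toFinset.1 he]

theorem flux_eq_iff (hf : Q.IsContinuousSolution E f ξ) (hz : z = E + (Q.kR : ℂ) ^ 2)
    (hs : ∀ e, Q.s e z (Q.len e) ≠ 0) :
    Q.flux f α = (Q.ε α : ℂ) • ξ α ↔
      (∑ᶠ e ∈ Q.outEdges α, (1 / Q.s e z (Q.len e)) • star (Q.τ e) (ξ (Q.tgt e))) +
          ∑ᶠ e ∈ Q.inEdges α, (1 / Q.s e z (Q.len e)) • Q.τ e (ξ (Q.src e)) =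
        ((∑ᶠ e ∈ Q.outEdges α, Q.c e z (Q.len e) / Q.s e z (Q.len e)) +
          (∑ᶠ e ∈ Q.inEdges α, Q.s' e z (Q.len e) / Q.s e z (Q.len e)) +
          (Q.ε α : ℂ)) • ξ α := by
  rw [flux, hf.finsum_covDeriv_outEdges hz hs, hf.finsum_covDeriv_inEdges hz hs, add_smul,
    add_smul, ← sub_eq_zero, ← sub_eq_zero (b := _ + _ + _)]
  refine Eq.congr_left ?_
  abel

end RashbaNetwork.IsContinuousSolution

lemma summable_comp_of_encard_fiber_le {ι κ : Type*} {h : κ → ℝ} (h0 : ∀ k, 0 ≤ h k)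
    (hs : Summable h) {π : ι → κ} {N : ℕ} (hN : ∀ k, (π ⁻¹' {k}).encard ≤ N) :
    Summable fun i => h (π i) := by
  classical
  have hcard : ∀ (S : Finset ι) (k : κ), {i ∈ S | π i = k}.card ≤ N := fun S k => by
    have hsub : (({i ∈ S | π i = k} : Finset ι) : Set ι) ⊆ π ⁻¹' {k} :=
      fun i hi => (Finset.mem_filter.1 hi).2
    have hle := (encard_le_encard hsub).trans (hN k)
    rwa [encard_coe_eq_coe_finsetCard, Nat.cast_le] at hle
  refine summable_of_sum_le (c := N * ∑' k, h k) (fun i => h0 (π i)) fun S => ?_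
  calc ∑ i ∈ S, h (π i)
      = ∑ k ∈ S.image π, ({i ∈ S | π i = k}.card : ℝ) * h k := by
        simp only [Finset.sum_comp h π, nsmul_eq_mul]
    _ ≤ ∑ k ∈ S.image π, N * h k := by
        gcongr with k
        exacts [h0 k, hcard S k]
    _ = N * ∑ k ∈ S.image π, h k := (Finset.mul_sum _ _ _).symm
    _ ≤ N * ∑' k, h k := by
        gcongr
        exact hs.sum_le_tsum _ fun k _ => h0 k

lemma memℓp_two_iff {ι : Type*} {E : ι → Type*} [∀ i, NormedAddCommGroup (E i)] {f : ∀ i, E i} :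
    Memℓp f 2 ↔ Summable fun i => ‖f i‖ ^ 2 := by
  simp [memℓp_gen_iff (p := 2) (by norm_num)]

namespace RashbaNetwork

variable (Q : RashbaNetwork)

lemma encard_outEdges (α : Q.Vertex) :
    (Q.outEdges α).encard = {e ∈ Q.edges | e.1 = α.1}.encard := by
  have hpre : Q.outEdges α = Subtype.val ⁻¹' {e | e.1 = α.1} := ext fun _ => Subtype.ext_iff
  rw [hpre, ← Subtype.val_injective.encard_image, Subtype.image_preimage_coe]
  rfl

lemma encard_inEdges (α : Q.Vertex) :
    (Q.inEdges α).encard = {e ∈ Q.edges | e.2 = α.1}.encard := by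
  have hpre : Q.inEdges α = Subtype.val ⁻¹' {e | e.2 = α.1} := ext fun _ => Subtype.ext_iff
  rw [hpre, ← Subtype.val_injective.encard_image, Subtype.image_preimage_coe]
  rfl

lemma exists_encard_outEdges_add_encard_inEdges_le :
    ∃ N : ℕ, ∀ α, (Q.outEdges α).encard + (Q.inEdges α).encard ≤ N := by
  obtain ⟨N, hN⟩ := Q.degree_bounds
  refine ⟨N, fun α => ?_⟩
  rw [encard_outEdges, encard_inEdges]
  exact (hN α.1 α.2).2

variable {Q}

lemma exists_src_eq_or_tgt_eq (α : Q.Vertex) : ∃ e, Q.src e = α ∨ Q.tgt e = α := by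
  obtain ⟨N, hN⟩ := Q.degree_bounds
  have hdeg : 1 ≤ (Q.outEdges α).encard + (Q.inEdges α).encard := by
    rw [encard_outEdges, encard_inEdges]
    exact (hN α.1 α.2).1
  by_contra! hne
  have hout : Q.outEdges α = ∅ := eq_empty_of_forall_notMem fun e => (hne e).1
  have hin : Q.inEdges α = ∅ := eq_empty_of_forall_notMem fun e => (hne e).2
  simp [hout, hin] at hdeg

lemma summable_comp_of_src_eq_or_tgt_eq {h : Q.Edge → ℝ} (h0 : ∀ e, 0 ≤ h e) (hs : Summable h)
    {π : Q.Vertex → Q.Edge} (hπ : ∀ α, Q.src (π α) = α ∨ Q.tgt (π α) = α) :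
    Summable fun α => h (π α) := by
  refine summable_comp_of_encard_fiber_le h0 hs (N := 2) fun e => ?_
  have hsub : π ⁻¹' {e} ⊆ {Q.src e, Q.tgt e} := by
    rintro α rfl
    exact (hπ α).imp Eq.symm Eq.symm
  exact (encard_le_encard hsub).trans ((encard_insert_le _ _).trans (by simp [one_add_one_eq_two]))

lemma summable_src_add_tgt {h : Q.Vertex → ℝ} (h0 : ∀ α, 0 ≤ h α) (hs : Summable h) :
    Summable fun e => h (Q.src e) + h (Q.tgt e) := by
  obtain ⟨N, hN⟩ := Q.exists_encard_outEdges_add_encard_inEdges_le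
  exact (summable_comp_of_encard_fiber_le h0 hs fun α => le_self_add.trans (hN α)).add
    (summable_comp_of_encard_fiber_le h0 hs fun α => le_add_self.trans (hN α))

lemma squareIntegrable_iff {f : Q.Edge → ℝ → Spinor} (hf : ∀ e, MemLp (f e) 2 (Q.edgeMeasure e)) :
    Q.SquareIntegrable f ↔ Summable fun e => lpNorm (f e) 2 (Q.edgeMeasure e) ^ 2 := by
  constructor
  · rintro ⟨u, hu⟩
    refine (memℓp_two_iff.1 (lp.memℓp u)).congr fun e => ?_
    rw [Lp.norm_def, eLpNorm_congr_ae (hu e), toReal_eLpNorm (hf e).1]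
  · intro hsum
    have hmem : Memℓp (fun e => (hf e).toLp (f e)) 2 := by
      refine memℓp_two_iff.2 (hsum.congr fun e => ?_)
      rw [Lp.norm_toLp, toReal_eLpNorm (hf e).1]
    exact ⟨⟨_, hmem⟩, fun e => (hf e).coeFn_toLp⟩

namespace IsContinuousSolution

variable {E : ℂ} {f : Q.Edge → ℝ → Spinor} {ξ : Q.Vertex → Spinor}

lemma memLp (hf : Q.IsContinuousSolution E f ξ) (e : Q.Edge) :
    MemLp (f e) 2 (Q.edgeMeasure e) :=
  memLp_of_continuousOn_Icc (hf.memH2 e).differentiableOn.continuousOn 2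

lemma lpNorm_gaugeTransform (hf : Q.IsContinuousSolution E f ξ) (e : Q.Edge) :
    lpNorm (Q.gaugeTransform e (f e)) 2 (Q.edgeMeasure e) = lpNorm (f e) 2 (Q.edgeMeasure e) := by
  obtain ⟨g', hg⟩ := hf.exists_isHillSolution_gaugeTransform e
  rw [← lpNorm_Θ (memLp_of_continuousOn_Icc (hg.continuousOn (Q.len_pos e).le) 2),
    Θ_gaugeTransform]

lemma exists_norm_add_norm_le (hf : Q.IsContinuousSolution E f ξ) :
    ∃ C : ℝ, ∀ e, ‖ξ (Q.src e)‖ + ‖ξ (Q.tgt e)‖ ≤ C * lpNorm (f e) 2 (Q.edgeMeasure e) := by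
  obtain ⟨C, hC⟩ := Q.exists_norm_boundary_le (E + (Q.kR : ℂ) ^ 2)
  refine ⟨C, fun e => ?_⟩
  obtain ⟨g', hg⟩ := hf.exists_isHillSolution_gaugeTransform e
  have hle := hC e _ _ hg
  rwa [norm_gaugeTransform, norm_gaugeTransform, (hf.vertexValues e).1, (hf.vertexValues e).2,
    hf.lpNorm_gaugeTransform] at hle

lemma exists_lpNorm_le (hf : Q.IsContinuousSolution E f ξ)
    (hE : E ∉ Q.dirichletOp.unboundedSpectrum) :
    ∃ C : ℝ, ∀ e, lpNorm (f e) 2 (Q.edgeMeasure e) ≤ C * (‖ξ (Q.src e)‖ + ‖ξ (Q.tgt e)‖) := by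
  obtain ⟨C, hC⟩ := Q.exists_lpNorm_le_norm_boundary hE
  refine ⟨C, fun e => ?_⟩
  obtain ⟨g', hg⟩ := hf.exists_isHillSolution_gaugeTransform e
  have hle := hC e _ _ hg
  rwa [norm_gaugeTransform, norm_gaugeTransform, (hf.vertexValues e).1, (hf.vertexValues e).2,
    hf.lpNorm_gaugeTransform] at hle

lemma memℓp_of_squareIntegrable (hf : Q.IsContinuousSolution E f ξ)
    (hsq : Q.SquareIntegrable f) : Memℓp ξ 2 := by
  obtain ⟨C, hC⟩ := hf.exists_norm_add_norm_le
  choose π hπ using exists_src_eq_or_tgt_eq (Q := Q)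
  have hle : ∀ α, ‖ξ α‖ ≤ C * lpNorm (f (π α)) 2 (Q.edgeMeasure (π α)) := fun α => by
    refine le_trans ?_ (hC (π α))
    obtain hα | hα := hπ α
    · rw [hα]
      exact le_add_of_nonneg_right (norm_nonneg _)
    · rw [hα]
      exact le_add_of_nonneg_left (norm_nonneg _)
  have hsum := summable_comp_of_src_eq_or_tgt_eq (fun _ => sq_nonneg _)
    ((squareIntegrable_iff hf.memLp).1 hsq) hπ
  refine memℓp_two_iff.2 (.of_nonneg_of_le (fun α => sq_nonneg _) (fun α => ?_)
    (hsum.mul_left (C ^ 2)))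
  rw [← mul_pow]
  exact pow_le_pow_left₀ (norm_nonneg _) (hle α) 2

lemma squareIntegrable_of_memℓp (hf : Q.IsContinuousSolution E f ξ)
    (hE : E ∉ Q.dirichletOp.unboundedSpectrum) (hξ : Memℓp ξ 2) : Q.SquareIntegrable f := by
  obtain ⟨C, hC⟩ := hf.exists_lpNorm_le hE
  have hsum := summable_src_add_tgt (fun _ => sq_nonneg _) (memℓp_two_iff.1 hξ)
  refine (squareIntegrable_iff hf.memLp).2 (.of_nonneg_of_le (fun e => sq_nonneg _) (fun e => ?_)
    (hsum.mul_left (C ^ 2 * 2)))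
  calc lpNorm (f e) 2 (Q.edgeMeasure e) ^ 2
      ≤ (C * (‖ξ (Q.src e)‖ + ‖ξ (Q.tgt e)‖)) ^ 2 := pow_le_pow_left₀ lpNorm_nonneg (hC e) 2
    _ = C ^ 2 * (‖ξ (Q.src e)‖ + ‖ξ (Q.tgt e)‖) ^ 2 := mul_pow _ _ _
    _ ≤ C ^ 2 * (2 * (‖ξ (Q.src e)‖ ^ 2 + ‖ξ (Q.tgt e)‖ ^ 2)) := by
        gcongr
        exact add_sq_le
    _ = C ^ 2 * 2 * (‖ξ (Q.src e)‖ ^ 2 + ‖ξ (Q.tgt e)‖ ^ 2) := (mul_assoc _ _ _).symm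

theorem squareIntegrable_iff_memℓp (hf : Q.IsContinuousSolution E f ξ)
    (hE : E ∉ Q.dirichletOp.unboundedSpectrum) : Q.SquareIntegrable f ↔ Memℓp ξ 2 :=
  ⟨hf.memℓp_of_squareIntegrable, hf.squareIntegrable_of_memℓp hE⟩

theorem isEigenfunction_iff (hf : Q.IsContinuousSolution E f ξ)
    (hflux : ∀ α, Q.flux f α = (Q.ε α : ℂ) • ξ α)
    (hne : ∃ e, ∃ t ∈ Icc 0 (Q.len e), f e t ≠ 0) :
    Q.IsEigenfunction E f ↔ Q.SquareIntegrable f := by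
  refine ⟨fun ⟨u, _, hu, _⟩ => ⟨u, hu⟩, fun ⟨u, hu⟩ => ?_⟩
  have hmax : (u, E • u) ∈ Q.maximalOp.graph := by
    rw [graph_maximalOp]
    exact ⟨f, hf.memH2, hu, fun e => (hu.smul E e).trans (Filter.EventuallyEq.symm (hf.equation e))⟩
  have hdom : u ∈ Q.hamiltonianDomain := ⟨f, ξ, hf.memH2, hu, hf.vertexValues, hflux⟩
  obtain ⟨x, rfl, hx⟩ := (LinearPMap.mem_graph_iff _).1
    (mem_graph_domRestrict_iff.2 ⟨hmax, hdom⟩)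
  refine ⟨x, fun hx0 => ?_, hu, hx⟩
  obtain ⟨e, t, ht, hft⟩ := hne
  rw [hx0] at hu
  exact hft (Q.eqOn_of_represents hf.memH2 (fun _ => MemH2.zero) hu Q.represents_zero e ht)

end IsContinuousSolution

end RashbaNetwork

theorem mainTheorem9 (Q : RashbaNetwork) (E : ℂ) (hE : E ∉ Q.dirichletOp.unboundedSpectrum)
    (z : ℂ) (hz : z = E + (Q.kR : ℂ) ^ 2) :
    (∀ e : Q.Edge, Q.IsSineSolution e z (Q.s e z) ∧ Q.IsCosineSolution e z (Q.c e z) ∧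
      Q.s e z (Q.len e) ≠ 0) ∧
    ∀ (f : Q.Edge → ℝ → Spinor) (ξ : Q.Vertex → Spinor), Q.IsContinuousSolution E f ξ →
      (∀ e : Q.Edge, ∀ t ∈ Set.Icc 0 (Q.len e),
        f e t = (Q.s e z t / Q.s e z (Q.len e)) •
            Q.Θ e t (star (Q.τ e) (ξ (Q.tgt e)) - Q.c e z (Q.len e) • ξ (Q.src e)) +
          Q.Θ e t (Q.c e z t • ξ (Q.src e))) ∧
      (∀ α : Q.Vertex, Q.flux f α = (Q.ε α : ℂ) • ξ α ↔
        (∑ᶠ e ∈ Q.outEdges α, (1 / Q.s e z (Q.len e)) • star (Q.τ e) (ξ (Q.tgt e))) +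
            ∑ᶠ e ∈ Q.inEdges α, (1 / Q.s e z (Q.len e)) • Q.τ e (ξ (Q.src e)) =
          ((∑ᶠ e ∈ Q.outEdges α, Q.c e z (Q.len e) / Q.s e z (Q.len e)) +
            (∑ᶠ e ∈ Q.inEdges α, Q.s' e z (Q.len e) / Q.s e z (Q.len e)) +
            (Q.ε α : ℂ)) • ξ α) ∧
      (Q.SquareIntegrable f ↔ Memℓp ξ 2) ∧
      ((∀ α : Q.Vertex, Q.flux f α = (Q.ε α : ℂ) • ξ α) →
        (∃ e : Q.Edge, ∃ t ∈ Set.Icc 0 (Q.len e), f e t ≠ 0) →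
        (Q.IsEigenfunction E f ↔ Memℓp ξ 2)) := by
  have hs : ∀ e, Q.s e z (Q.len e) ≠ 0 := fun e => hz ▸ RashbaNetwork.s_len_ne_zero hE e
  refine ⟨fun e => ⟨Q.isSineSolution_s e z, Q.isCosineSolution_c e z, hs e⟩, fun f ξ hf => ?_⟩
  have hmem : Q.SquareIntegrable f ↔ Memℓp ξ 2 := hf.squareIntegrable_iff_memℓp hE
  exact ⟨fun e _ ht => hf.apply_eq hz (hs e) ht, fun _ => hf.flux_eq_iff hz hs, hmem,
    fun hflux hne => (hf.isEigenfunction_iff hflux hne).trans hmem⟩
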